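/- All digraphs are finite, without loops and without parallel arcs (opposite arcs $uv$, $vu$ are allowed). A digraph is connected if its underlying undirected graph is connected (in particular it is non-empty); a block of $D$ is a maximal connected subdigraph of $D$ that has no separating vertex, where $v$ is separating in $B$ if $B-v$ is disconnected (the vertex of a one-vertex digraph is not separating). $\mathcal B(D)$ is the set of blocks of $D$. A matching is a set of arcs no two of which have a common end-vertex, and $D[S]$ is the subdigraph induced by $S$. A cover of a digraph $D$ is a pair $(X,H)$, where $H$ is a digraph and $X$ assigns to each $v\in V(D)$ a set $X_v\subseteq V(H)$, such that the sets $X_v$ are pairwise disjoint and independent in $H$, $V(H)=\bigcup_{v\in V(D)}X_v$, for each arc $uv\in A(D)$ the arcs of $H$ from $X_u$ to $X_v$ form a (possibly empty) matching, and every arc of $H$ goes from $X_u$ to $X_v$ for some $uv\in A(D)$. The pair $(X,H)$ (or the triple $(D,X,H)$) is colorable if there is a set $T\subseteq V(H)$ with $|T\cap X_v|=1$ for all $v\in V(D)$ such that $H[T]$ contains no directed cycle (directed cycles have length at least $2$); otherwise it is uncolorable. The triple $(D,X,H)$ is a degree-feasible configuration if $D$ is connected, $(X,H)$ is a cover of $D$,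 and $|X_v|\ge\max\{d_D^+(v),d_D^-(v)\}$ for all $v\in V(D)$. It is minimal uncolorable if it is uncolorable but $(D,X,H-a)$ is colorable for every arc $a\in A(H)$. Let $(X,H)$ be a cover of $D$. * $(D,X,H)$ is a K-configuration if $D$ is a complete digraph (any two distinct vertices are joined by two opposite arcs) of order $n\ge1$, $|X_v|=n-1$ for all $v$, and the sets can be labeled $X_v=\{x_v^1,\dots,x_v^{n-1}\}$ such that each $H^i=H[\{x_v^i: v\in V(D)\}]$ is a complete digraph and $H=H^1\cup\dots\cup H^{n-1}$. * $(D,X,H)$ is a C-configuration if $D$ is a directed cycle of length at least $2$, $X_v=\{x_v\}$ for all $v$, and $A(H)=\{x_vx_u: vu\in A(D)\}$. * $(D,X,H)$ is an odd BC-configuration if $D$ is a bidirected cycle of odd length at least $5$ (an undirected cycle with each edge replaced by two opposite arcs), $|X_v|=2$ for all $v$, and the sets can be labeled $X_v=\{x_v^1,x_v^2\}$ such that $A(H)=\{x_v^ix_w^i: vw\in A(D),\ i\in\{1,2\}\}$. * $(D,X,H)$ is an even BC-configuration if $D$ is a bidirected cycle of even length at least $4$ and there is an arc $uu'\in A(D)$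 such that $|X_v|=2$ for all $v$ and the sets can be labeled $X_v=\{x_v^1,x_v^2\}$ such that $$A(H)=\{x_v^ix_w^i: vw\in A(D),\ \{v,w\}\ne\{u,u'\},\ i\in\{1,2\}\}\cup\{x_u^1x_{u'}^2,\ x_u^2x_{u'}^1,\ x_{u'}^2x_u^1,\ x_{u'}^1x_u^2\}.$$ * A BC-configuration is an odd or an even BC-configuration. **Corollary.** Let $(D,X,H)$ be a degree-feasible configuration that is minimal uncolorable. Then there is exactly one family $\big((X^B,H^B)\big)_{B\in\mathcal B(D)}$, where $(X^B,H^B)$ is a cover of $B$, such that the following statements hold. (a) For every block $B\in\mathcal B(D)$, the triple $(B,X^B,H^B)$ is a K-configuration, a C-configuration, or a BC-configuration. (b) The digraphs $H^B$ with $B\in\mathcal B(D)$ are pairwise (vertex-)disjoint, and $H=\bigcup_{B\in\mathcal B(D)}H^B$. (c) For each vertex $v\in V(D)$, $X_v=\bigcup_{B\in\mathcal B(D),\,v\in V(B)}X_v^B$. -/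

import Mathlib

/-- A finite digraph without loops and without parallel arcs (opposite arcs are allowed), whose
vertices are elements of `α`: a finite vertex set together with an arc relation `Arc u v`, read as
`uv` is an arc with initial vertex `u` and terminal vertex `v`. -/
@[ext]
structure FinDigraph (α : Type*) where
  verts : Set α
  finite_verts : verts.Finite
  Arc : α → α → Prop
  left_mem : ∀ {u v : α}, Arc u v → u ∈ verts
  right_mem : ∀ {u v : α}, Arc u v → v ∈ verts
  loopless : ∀ v : α, ¬ Arc v v

namespace FinDigraph

/-- `D ≤ D'` means that `D` is a subdigraph of `D'`. -/
instance instPartialOrder {α : Type*} : PartialOrder (FinDigraph α) where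
  le D D' := D.verts ⊆ D'.verts ∧ ∀ u v, D.Arc u v → D'.Arc u v
  le_refl D := ⟨Set.Subset.refl _, fun _ _ h => h⟩
  le_trans _ _ _ h h' := ⟨h.1.trans h'.1, fun u v e => h'.2 u v (h.2 u v e)⟩
  le_antisymm D D' h h' := by
    ext u v
    · exact ⟨fun e => h.1 e, fun e => h'.1 e⟩
    · exact ⟨h.2 u v, h'.2 u v⟩

/-- The subdigraph `D[S]` induced by the vertices of `D` that lie in `S`. -/
def induce {α : Type*} (D : FinDigraph α) (S : Set α) : FinDigraph α where
  verts := D.verts ∩ S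
  finite_verts := D.finite_verts.subset Set.inter_subset_left
  Arc u v := D.Arc u v ∧ u ∈ S ∧ v ∈ S
  left_mem h := ⟨D.left_mem h.1, h.2.1⟩
  right_mem h := ⟨D.right_mem h.1, h.2.2⟩
  loopless v h := D.loopless v h.1

/-- The digraph obtained from `D` by deleting the arc `xy` (and no vertices). -/
def deleteArc {α : Type*} (D : FinDigraph α) (x y : α) : FinDigraph α where
  verts := D.verts
  finite_verts := D.finite_verts
  Arc u v := D.Arc u v ∧ ¬ (u = x ∧ v = y)
  left_mem h := D.left_mem h.1
  right_mem h := D.right_mem h.1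
  loopless v h := D.loopless v h.1

/-- The out-degree of `v`. -/
noncomputable def outDegree {α : Type*} (D : FinDigraph α) (v : α) : ℕ := {u | D.Arc v u}.ncard

/-- The in-degree of `v`. -/
noncomputable def inDegree {α : Type*} (D : FinDigraph α) (v : α) : ℕ := {u | D.Arc u v}.ncard

/-- The underlying simple undirected graph. -/
def underlying {α : Type*} (D : FinDigraph α) : SimpleGraph D.verts where
  Adj u v := D.Arc u v ∨ D.Arc v u
  symm := ⟨fun _ _ h => h.symm⟩
  loopless := ⟨fun v h => h.elim (D.loopless v) (D.loopless v)⟩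

/-- (Weak) connectedness; in particular `D` has at least one vertex. -/
def IsConnected {α : Type*} (D : FinDigraph α) : Prop := D.underlying.Connected

/-- `v` is a separating vertex of `D`: the digraph `D - v` is disconnected, that is, it has two
vertices that are not joined by a path of the underlying graph. (So the vertex of a one-vertex
digraph is not separating.) -/
def IsSeparatingVertex {α : Type*} (D : FinDigraph α) (v : α) : Prop :=
  v ∈ D.verts ∧ ¬ (D.induce {v}ᶜ).underlying.Preconnected

/-- `B` is a block of `D`: a maximal connected subdigraph of `D` without separating vertex. -/
def IsBlock {α : Type*} (D B : FinDigraph α) : Prop :=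
  Maximal (fun B' : FinDigraph α =>
    B' ≤ D ∧ B'.IsConnected ∧ ∀ v, ¬ B'.IsSeparatingVertex v) B

/-- Complete digraphs: any two distinct vertices are joined by two opposite arcs. -/
def IsComplete {α : Type*} (D : FinDigraph α) : Prop :=
  ∀ u ∈ D.verts, ∀ v ∈ D.verts, u ≠ v → D.Arc u v

/-- `D` is a directed cycle of length `n`, with vertices `f 0, …, f (n - 1)` in cyclic order. -/
def IsDirectedCycle {α : Type*} (D : FinDigraph α) (n : ℕ) : Prop :=
  2 ≤ n ∧ ∃ f : ZMod n → α, Function.Injective f ∧ D.verts = Set.range f ∧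
    ∀ u v, D.Arc u v ↔ ∃ i, u = f i ∧ v = f (i + 1)

/-- `D` is a bidirected cycle of length `n`, obtained from an undirected cycle with vertices
`f 0, …, f (n - 1)` in cyclic order by replacing each edge by two opposite arcs. -/
def IsBidirectedCycle {α : Type*} (D : FinDigraph α) (n : ℕ) : Prop :=
  3 ≤ n ∧ ∃ f : ZMod n → α, Function.Injective f ∧ D.verts = Set.range f ∧
    ∀ u v, D.Arc u v ↔ ∃ i, (u = f i ∧ v = f (i + 1)) ∨ (u = f (i + 1) ∧ v = f i)

/-- `D` contains no directed cycle. -/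
def IsAcyclic {α : Type*} (D : FinDigraph α) : Prop :=
  ∀ (C : FinDigraph α) (n : ℕ), C ≤ D → ¬ C.IsDirectedCycle n

/-- `D` is the union of the digraphs `F i`. -/
def IsUnion {α ι : Type*} (D : FinDigraph α) (F : ι → FinDigraph α) : Prop :=
  D.verts = ⋃ i, (F i).verts ∧ ∀ u v, D.Arc u v ↔ ∃ i, (F i).Arc u v

/-- The set `E_D(S, T)` of arcs of `D` with initial vertex in `S` and terminal vertex in `T`. -/
def arcsBetween {α : Type*} (D : FinDigraph α) (S T : Set α) : Set (α × α) :=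
  {a | D.Arc a.1 a.2 ∧ a.1 ∈ S ∧ a.2 ∈ T}

end FinDigraph

/-- A set of arcs is a matching if no two distinct arcs in it have a common end-vertex. -/
def IsArcMatching {β : Type*} (M : Set (β × β)) : Prop :=
  ∀ a ∈ M, ∀ b ∈ M, a ≠ b → a.1 ≠ b.1 ∧ a.1 ≠ b.2 ∧ a.2 ≠ b.1 ∧ a.2 ≠ b.2

/-- A cover `(X, H)` of the digraph `D`, with colors in `β`. The map `X` is meant to be defined on
the vertex set of `D` only; this is encoded by the value `∅` at all other elements of `α`. -/
@[ext]
structure DigraphCover {α : Type*} (D : FinDigraph α) (β : Type*) where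
  X : α → Set β
  H : FinDigraph β
  X_eq_empty : ∀ v, v ∉ D.verts → X v = ∅
  disjoint : ∀ u ∈ D.verts, ∀ v ∈ D.verts, u ≠ v → Disjoint (X u) (X v)
  verts_eq : H.verts = ⋃ v ∈ D.verts, X v
  independent : ∀ v ∈ D.verts, ∀ x ∈ X v, ∀ y ∈ X v, ¬ H.Arc x y
  matching : ∀ u v, D.Arc u v → IsArcMatching (H.arcsBetween (X u) (X v))
  arc : ∀ x y, H.Arc x y → ∃ u v, D.Arc u v ∧ x ∈ X u ∧ y ∈ X v

namespace DigraphCover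

/-- The cover `(X, H - xy)`. -/
def deleteArc {α β : Type*} {D : FinDigraph α} (C : DigraphCover D β) (x y : β) :
    DigraphCover D β where
  X := C.X
  H := C.H.deleteArc x y
  X_eq_empty := C.X_eq_empty
  disjoint := C.disjoint
  verts_eq := C.verts_eq
  independent v hv a ha b hb h := C.independent v hv a ha b hb h.1
  matching u v huv a ha b hb hab :=
    C.matching u v huv a ⟨ha.1.1, ha.2⟩ b ⟨hb.1.1, hb.2⟩ hab
  arc a b h := C.arc a b h.1

/-- `T` is a transversal of `(X, H)`. -/
def IsTransversal {α β : Type*} {D : FinDigraph α} (C : DigraphCover D β) (T : Set β) : Prop :=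
  T ⊆ C.H.verts ∧ ∀ v ∈ D.verts, (T ∩ C.X v).ncard = 1

/-- `D` is `(X, H)`-colorable: there is an acyclic transversal of `(X, H)`. -/
def IsColorable {α β : Type*} {D : FinDigraph α} (C : DigraphCover D β) : Prop :=
  ∃ T : Set β, C.IsTransversal T ∧ (C.H.induce T).IsAcyclic

/-- `(D, X, H)` is a degree-feasible configuration. -/
def IsDegreeFeasible {α β : Type*} {D : FinDigraph α} (C : DigraphCover D β) : Prop :=
  D.IsConnected ∧ ∀ v ∈ D.verts, max (D.outDegree v) (D.inDegree v) ≤ (C.X v).ncard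

/-- `(D, X, H)` is a minimal uncolorable configuration. -/
def IsMinimalUncolorable {α β : Type*} {D : FinDigraph α} (C : DigraphCover D β) : Prop :=
  D.IsConnected ∧ ¬ C.IsColorable ∧ ∀ x y, C.H.Arc x y → (C.deleteArc x y).IsColorable

/-- For every vertex `v` of `D`, the family `x v 0, …, x v (k - 1)` is a labeling of the vertices
of `X_v` (without repetitions). -/
def IsLabeling {α β : Type*} {D : FinDigraph α} (C : DigraphCover D β) {k : ℕ}
    (x : α → Fin k → β) : Prop :=
  ∀ v ∈ D.verts, Function.Injective (x v) ∧ Set.range (x v) = C.X v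

/-- `(D, X, H)` is a K-configuration. -/
def IsKConfiguration {α β : Type*} {D : FinDigraph α} (C : DigraphCover D β) : Prop :=
  ∃ n : ℕ, 1 ≤ n ∧ D.IsComplete ∧ D.verts.ncard = n ∧
    (∀ v ∈ D.verts, (C.X v).ncard = n - 1) ∧
    ∃ x : α → Fin (n - 1) → β, C.IsLabeling x ∧
      (∀ i, (C.H.induce {y | ∃ v ∈ D.verts, y = x v i}).IsComplete) ∧
      C.H.IsUnion fun i => C.H.induce {y | ∃ v ∈ D.verts, y = x v i}

/-- `(D, X, H)` is a C-configuration. -/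
def IsCConfiguration {α β : Type*} {D : FinDigraph α} (C : DigraphCover D β) : Prop :=
  (∃ n : ℕ, D.IsDirectedCycle n) ∧
    ∃ x : α → β, (∀ v ∈ D.verts, C.X v = {x v}) ∧
      ∀ a b, C.H.Arc a b ↔ ∃ v u, D.Arc v u ∧ a = x v ∧ b = x u

/-- `(D, X, H)` is an odd BC-configuration. -/
def IsOddBCConfiguration {α β : Type*} {D : FinDigraph α} (C : DigraphCover D β) : Prop :=
  (∃ n : ℕ, Odd n ∧ 5 ≤ n ∧ D.IsBidirectedCycle n) ∧
    (∀ v ∈ D.verts, (C.X v).ncard = 2) ∧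
    ∃ x : α → Fin 2 → β, C.IsLabeling x ∧
      ∀ a b, C.H.Arc a b ↔ ∃ v w i, D.Arc v w ∧ a = x v i ∧ b = x w i

/-- `(D, X, H)` is an even BC-configuration. -/
def IsEvenBCConfiguration {α β : Type*} {D : FinDigraph α} (C : DigraphCover D β) : Prop :=
  (∃ n : ℕ, Even n ∧ 4 ≤ n ∧ D.IsBidirectedCycle n) ∧
    ∃ u u' : α, D.Arc u u' ∧
      (∀ v ∈ D.verts, (C.X v).ncard = 2) ∧
      ∃ x : α → Fin 2 → β, C.IsLabeling x ∧
        ∀ a b, C.H.Arc a b ↔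
          (∃ v w i, ({v, w} : Set α) ≠ {u, u'} ∧ D.Arc v w ∧ a = x v i ∧ b = x w i) ∨
          (∃ i j, i ≠ j ∧ ((a = x u i ∧ b = x u' j) ∨ (a = x u' i ∧ b = x u j)))

/-- `(D, X, H)` is a BC-configuration. -/
def IsBCConfiguration {α β : Type*} {D : FinDigraph α} (C : DigraphCover D β) : Prop :=
  C.IsOddBCConfiguration ∨ C.IsEvenBCConfiguration

end DigraphCover

/-! The basic object is a hole: an acyclic transversal of `D - v`, with `v` left uncolored (`Hole`).
Any color put at `v` closes a directed cycle through `v`, so it has an out-neighbor and an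
in-neighbor among the chosen colors. Arcs between two color sets form matchings and `|X_v| ≥ max
(d⁺, d⁻)`, so counting yields bijections from `X_v` to the out-neighbors and to the in-neighbors of
`v` (`Hole.bijective_out`, `Hole.bijective_in`). This rigidity allows a hole to move: coloring `v`
and uncoloring the neighbor matched to that color creates no cycle (`Hole.slide_full`). By
minimality and connectivity every vertex can be a hole, unless `D` is a single vertex without
colors.

Shape of the blocks: the directed cycle closed by a color is induced in `D`
(`ColorCycle.chordless`), and if its length is at least three it fills its block
(`ColorCycle.range_eq`). Hence a block is a directed cycle or symmetric. In a symmetric block,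
moving a hole once around a cycle and comparing colors before and after (`Hole.arc_of_walk`) gives a
purely graph-theoretic property, `LinkInjective`, which only complete digraphs and bidirected cycles
have.

Splitting the colors: over all holes at `v`, the out-neighbors of a color `x` stay in one component
of `D - v` (`Hole.conn_out_out`), hence in one block. This partitions `X_v` into the sets `blockX`,
and arcs of `H` over a block join colors of that block (`mem_blockX_of_arc`). In a complete block
the matchings compose along triangles; around a bidirected cycle they compose to a permutation of
two labels determined by parity.

Uniqueness holds because each color of a K-, C- or BC-configuration has an arc inside it, which
reveals the block it must belong to. -/

open Relation

/-! ### Cyclic indices and closed walks. -/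

theorem ZMod.val_add_one_eq_mod {n : ℕ} [NeZero n] (i : ZMod n) : (i + 1).val = (i.val + 1) % n := by
  rw [ZMod.val_add, ZMod.val_one_eq_one_mod, Nat.add_mod_mod]

/-- Walking forward around `ZMod n` from `j` one reaches `k - 1` before the next visit to `k`. -/
theorem ZMod.forward_induction {n : ℕ} [NeZero n] {P : ZMod n → Prop} {j k : ZMod n}
    (hj : P j) (step : ∀ i, P i → i + 1 ≠ k → P (i + 1)) : P (k - 1) := by
  have key : ∀ m : ℕ, (∀ l : ℕ, 1 ≤ l → l ≤ m → j + (l : ZMod n) ≠ k) → P (j + (m : ZMod n)) := by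
    intro m
    induction m with
    | zero => intro _; simpa using hj
    | succ m ih =>
      intro h
      have h1 := ih fun l hl hm => h l hl (by omega)
      have h2 := step _ h1 (by simpa [add_assoc] using h (m + 1) (by omega) le_rfl)
      simpa [add_assoc] using h2
  have h := key (k - 1 - j).val ?_
  · simpa using h
  · intro l hl hm hk
    have h1 : k - 1 - j = ((l - 1 : ℕ) : ZMod n) := by
      rw [← hk, Nat.cast_sub hl]; push_cast; ring
    have h2 := ZMod.val_lt (k - 1 - j)
    have h3 : (k - 1 - j).val = l - 1 := by
      rw [h1, ZMod.val_natCast_of_lt (by omega)]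
    omega

namespace Relation

theorem TransGen.exists_seq {α : Type*} {r : α → α → Prop} {a b : α} (h : TransGen r a b) :
    ∃ (n : ℕ) (g : ℕ → α), 0 < n ∧ g 0 = a ∧ g n = b ∧ ∀ i < n, r (g i) (g (i + 1)) := by
  induction h with
  | single h =>
    rename_i c
    refine ⟨1, fun i => if i = 0 then a else c, by simp, by simp, by simp, fun i hi => ?_⟩
    obtain rfl : i = 0 := by omega
    simpa using h
  | tail _ h ih =>
    rename_i b c _
    obtain ⟨n, g, hn, h0, h1, hs⟩ := ih
    refine ⟨n + 1, fun i => if i ≤ n then g i else c, by simp, by simpa, by simp, fun i hi => ?_⟩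
    rcases Nat.lt_succ_iff_lt_or_eq.1 hi with hi | rfl
    · simpa [hi.le, Nat.succ_le_of_lt hi] using hs i hi
    · simpa [h1] using h

/-- A closed walk through `a` contains a cycle through `a`, provided it is chosen shortest. -/
theorem TransGen.exists_cycle {α : Type*} {r : α → α → Prop} {a : α} (h : TransGen r a a) :
    ∃ (n : ℕ) (_ : NeZero n) (f : ZMod n → α), Function.Injective f ∧ f 0 = a ∧
      ∀ i, r (f i) (f (i + 1)) := by
  classical
  have hex : ∃ n, ∃ g : ℕ → α, 0 < n ∧ g 0 = a ∧ g n = a ∧ ∀ i < n, r (g i) (g (i + 1)) :=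
    h.exists_seq
  obtain ⟨g, hn, h0, h1, hs⟩ := Nat.find_spec hex
  have hmin := fun m => Nat.find_min hex (m := m)
  generalize Nat.find hex = n at *
  have : NeZero n := ⟨hn.ne'⟩
  -- A repetition could be cut out, leaving a shorter closed walk through `a`.
  have hinj : ∀ i j, i < j → j < n → g i ≠ g j := by
    intro i j hij hj he
    refine hmin (n - (j - i)) (by omega)
      ⟨fun k => if k ≤ i then g k else g (k + (j - i)), by omega, by simpa, ?_, ?_⟩
    · have : ¬ n - (j - i) ≤ i := by omega
      have h2 : n - (j - i) + (j - i) = n := by omega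
      simp [this, h2, h1]
    · intro k hk
      rcases lt_trichotomy k i with hki | rfl | hki
      · simpa [hki.le, Nat.succ_le_of_lt hki] using hs k (by omega)
      · have h2 : k + 1 + (j - k) = j + 1 := by omega
        simpa [h2, he] using hs j hj
      · have h2 : k + 1 + (j - i) = k + (j - i) + 1 := by omega
        have h3 : ¬ k ≤ i := by omega
        have h4 : ¬ k + 1 ≤ i := by omega
        simpa [h2, h3, h4] using hs (k + (j - i)) (by omega)
  refine ⟨n, inferInstance, fun i => g i.val, ?_, by simpa, ?_⟩
  · intro i j hij
    apply ZMod.val_injective n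
    rcases lt_trichotomy i.val j.val with hl | hl | hl
    · exact absurd hij (hinj _ _ hl (ZMod.val_lt j))
    · exact hl
    · exact absurd hij.symm (hinj _ _ hl (ZMod.val_lt i))
  · intro i
    have hi := ZMod.val_lt i
    have := hs i.val hi
    simp only [ZMod.val_add_one_eq_mod]
    rcases Nat.lt_or_ge (i.val + 1) n with hlt | hge
    · rwa [Nat.mod_eq_of_lt hlt]
    · have he : i.val + 1 = n := by omega
      rw [he] at this ⊢
      rwa [Nat.mod_self, h0, ← h1]

theorem transGen_of_cycle {α : Type*} {r : α → α → Prop} {n : ℕ} [NeZero n] {f : ZMod n → α}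
    (h : ∀ i, r (f i) (f (i + 1))) (i : ZMod n) : TransGen r (f i) (f i) := by
  have key : ∀ m : ℕ, TransGen r (f i) (f (i + ((m + 1 : ℕ) : ZMod n))) := by
    intro m
    induction m with
    | zero => simpa using TransGen.single (h i)
    | succ m ih =>
      refine ih.tail ?_
      have := h (i + ((m + 1 : ℕ) : ZMod n))
      rw [add_assoc] at this
      exact_mod_cast this
  have h1 := key (n - 1)
  rwa [Nat.sub_add_cancel (NeZero.one_le), ZMod.natCast_self, add_zero] at h1

/-- Stopping a walk at the first vertex with property `P`. -/
theorem ReflTransGen.exists_first {α : Type*} {r : α → α → Prop} {P : α → Prop} {a b : α}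
    (h : ReflTransGen r a b) (hb : P b) :
    ∃ c, P c ∧ ReflTransGen (fun x y => r x y ∧ ¬ P x) a c ∧ ReflTransGen r c b := by
  induction h using ReflTransGen.head_induction_on with
  | refl => exact ⟨b, hb, .refl, .refl⟩
  | head h1 h2 ih =>
    rename_i a c
    by_cases ha : P a
    · exact ⟨a, ha, .refl, .head h1 h2⟩
    · obtain ⟨d, hd, h3, h4⟩ := ih
      exact ⟨d, hd, .head ⟨h1, ha⟩ h3, h4⟩

/-- A closed walk either avoids `v` or can be rotated to start at `v`. -/
theorem TransGen.avoid_or_through {α : Type*} {r : α → α → Prop} {a : α} (v : α)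
    (h : TransGen r a a) :
    TransGen (fun x y => r x y ∧ x ≠ v ∧ y ≠ v) a a ∨ TransGen r v v := by
  have key : ∀ b, TransGen r a b →
      TransGen (fun x y => r x y ∧ x ≠ v ∧ y ≠ v) a b ∨
        (ReflTransGen r a v ∧ ReflTransGen r v b) := by
    intro b hb
    induction hb with
    | single h =>
      rename_i b
      by_cases ha : a = v
      · subst ha; exact .inr ⟨.refl, .single h⟩
      · by_cases hbv : b = v
        · subst hbv; exact .inr ⟨.single h, .refl⟩
        · exact .inl (.single ⟨h, ha, hbv⟩)
    | tail h1 h ih =>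
      rename_i b c
      rcases ih with ih | ⟨h3, h4⟩
      · by_cases hb : b = v
        · subst hb; exact .inr ⟨h1.to_reflTransGen, .single h⟩
        · by_cases hc : c = v
          · subst hc; exact .inr ⟨(h1.tail h).to_reflTransGen, .refl⟩
          · exact .inl (ih.tail ⟨h, hb, hc⟩)
      · exact .inr ⟨h3, h4.tail h⟩
  rcases key a h with h1 | ⟨h1, h2⟩
  · exact .inl h1
  -- The whole closed walk `h` is inserted to keep the walk nonempty when `a = v`.
  · exact .inr (TransGen.trans_left (TransGen.trans_right h2 h) h1)

end Relation

/-! ### Connectivity, nonseparable vertex sets and blocks. -/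

namespace FinDigraph

variable {α : Type*} {D B : FinDigraph α} {S S' : Set α} {a b u v w : α}

/-- Adjacency of the underlying graph of `D` within the vertex set `S`. -/
def AdjOn (D : FinDigraph α) (S : Set α) (a b : α) : Prop :=
  a ∈ S ∧ b ∈ S ∧ (D.Arc a b ∨ D.Arc b a)

theorem AdjOn.symm (h : D.AdjOn S a b) : D.AdjOn S b a := ⟨h.2.1, h.1, h.2.2.symm⟩

theorem AdjOn.mono (hS : S ⊆ S') (h : D.AdjOn S a b) : D.AdjOn S' a b :=
  ⟨hS h.1, hS h.2.1, h.2.2⟩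

theorem ne_of_arc (h : D.Arc a b) : a ≠ b := fun e => D.loopless b (e ▸ h)

theorem AdjOn.ne (h : D.AdjOn S a b) : a ≠ b :=
  h.2.2.elim ne_of_arc fun h => (ne_of_arc h).symm

theorem reflTransGen_adjOn_symm (h : ReflTransGen (D.AdjOn S) a b) :
    ReflTransGen (D.AdjOn S) b a := by
  induction h with
  | refl => exact .refl
  | tail _ h ih => exact .head h.symm ih

theorem reflTransGen_adjOn_mono (hS : S ⊆ S') (h : ReflTransGen (D.AdjOn S) a b) :
    ReflTransGen (D.AdjOn S') a b :=
  h.lift id fun _ _ => AdjOn.mono hS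

theorem mem_of_reflTransGen_adjOn (h : ReflTransGen (D.AdjOn S) a b) (ha : a ∈ S) : b ∈ S := by
  cases h with
  | refl => exact ha
  | tail _ h => exact h.2.1

/-- The subdigraph of `D` on the vertex set `S` is connected or empty. -/
def ConnOn (D : FinDigraph α) (S : Set α) : Prop :=
  ∀ a ∈ S, ∀ b ∈ S, ReflTransGen (D.AdjOn S) a b

theorem ConnOn.union (h : D.ConnOn S) (h' : D.ConnOn S') (hv : v ∈ S) (hv' : v ∈ S') :
    D.ConnOn (S ∪ S') := by
  have key : ∀ a ∈ S ∪ S', ReflTransGen (D.AdjOn (S ∪ S')) a v := by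
    rintro a (ha | ha)
    · exact reflTransGen_adjOn_mono Set.subset_union_left (h a ha v hv)
    · exact reflTransGen_adjOn_mono Set.subset_union_right (h' a ha v hv')
  exact fun a ha b hb => (key a ha).trans (reflTransGen_adjOn_symm (key b hb))

theorem connOn_of_forall (h : ∀ a ∈ S, ReflTransGen (D.AdjOn S) a v) : D.ConnOn S :=
  fun a ha b hb => (h a ha).trans (reflTransGen_adjOn_symm (h b hb))

theorem underlying_preconnected_iff : D.underlying.Preconnected ↔ D.ConnOn D.verts := by
  constructor
  · intro h a ha b hb
    have h1 := h ⟨a, ha⟩ ⟨b, hb⟩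
    rw [SimpleGraph.reachable_iff_reflTransGen] at h1
    exact h1.lift Subtype.val fun x y hxy => ⟨x.2, y.2, hxy⟩
  · intro h
    rintro ⟨a, ha⟩ ⟨b, hb⟩
    rw [SimpleGraph.reachable_iff_reflTransGen]
    have h1 := h a ha b hb
    clear h
    induction h1 with
    | refl => exact .refl
    | tail _ h2 ih => exact (ih h2.1).tail h2.2.2

theorem isConnected_iff : D.IsConnected ↔ D.verts.Nonempty ∧ D.ConnOn D.verts := by
  rw [IsConnected, SimpleGraph.connected_iff, underlying_preconnected_iff,
    Set.nonempty_coe_sort, and_comm]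

theorem connOn_congr (h : ∀ a ∈ S, ∀ b ∈ S, B.Arc a b ↔ D.Arc a b) : B.ConnOn S ↔ D.ConnOn S := by
  have : B.AdjOn S = D.AdjOn S := by
    ext a b
    unfold AdjOn
    constructor
    · rintro ⟨ha, hb, h1⟩; exact ⟨ha, hb, by rwa [← h a ha b hb, ← h b hb a ha]⟩
    · rintro ⟨ha, hb, h1⟩; exact ⟨ha, hb, by rwa [h a ha b hb, h b hb a ha]⟩
  rw [ConnOn, ConnOn, this]

theorem ConnOn.mono_digraph (h : ∀ a b, B.Arc a b → D.Arc a b) (hB : B.ConnOn S) : D.ConnOn S :=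
  fun a ha b hb => (hB a ha b hb).lift id fun _ _ h1 =>
    ⟨h1.1, h1.2.1, h1.2.2.imp (h _ _) (h _ _)⟩

theorem isSeparatingVertex_iff :
    D.IsSeparatingVertex v ↔ v ∈ D.verts ∧ ¬ D.ConnOn (D.verts \ {v}) := by
  rw [IsSeparatingVertex, underlying_preconnected_iff]
  have h1 : (D.induce {v}ᶜ).verts = D.verts \ {v} := rfl
  rw [h1, connOn_congr (D := D)]
  intro a ha b hb
  exact ⟨fun h => h.1, fun h => ⟨h, ha.2, hb.2⟩⟩

/-- The vertex set `S` induces a connected subdigraph of `D` without separating vertex. -/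
structure Nonsep (D : FinDigraph α) (S : Set α) : Prop where
  nonempty : S.Nonempty
  subset : S ⊆ D.verts
  conn : D.ConnOn S
  conn_diff : ∀ v, D.ConnOn (S \ {v})

theorem Nonsep.of_le (hle : B ≤ D) (hc : B.IsConnected) (hs : ∀ v, ¬ B.IsSeparatingVertex v) :
    D.Nonsep B.verts := by
  obtain ⟨hne, hconn⟩ := isConnected_iff.1 hc
  refine ⟨hne, hle.1, hconn.mono_digraph hle.2, fun v => ?_⟩
  by_cases hv : v ∈ B.verts
  · have := hs v
    rw [isSeparatingVertex_iff] at this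
    push Not at this
    exact (this hv).mono_digraph hle.2
  · rw [Set.sdiff_singleton_eq_self hv]
    exact hconn.mono_digraph hle.2

theorem induce_le (D : FinDigraph α) (S : Set α) : D.induce S ≤ D :=
  ⟨Set.inter_subset_left, fun _ _ h => h.1⟩

theorem Nonsep.induce (h : D.Nonsep S) :
    D.induce S ≤ D ∧ (D.induce S).IsConnected ∧ ∀ v, ¬ (D.induce S).IsSeparatingVertex v := by
  have hv : (D.induce S).verts = S := Set.inter_eq_right.2 h.subset
  refine ⟨induce_le D S, ?_, fun v => ?_⟩
  · rw [isConnected_iff, hv, connOn_congr (D := D)]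
    · exact ⟨h.nonempty, h.conn⟩
    · exact fun a ha b hb => ⟨fun h => h.1, fun h => ⟨h, ha, hb⟩⟩
  · rw [isSeparatingVertex_iff, hv, connOn_congr (D := D)]
    · exact fun h1 => h1.2 (h.conn_diff v)
    · exact fun a ha b hb => ⟨fun h => h.1, fun h => ⟨h, ha.1, hb.1⟩⟩

/-- Two common vertices are needed because after the removal of one the other still joins the two
pieces. -/
theorem Nonsep.union (h : D.Nonsep S) (h' : D.Nonsep S') (hu : u ∈ S ∩ S') (hv : v ∈ S ∩ S')
    (huv : u ≠ v) : D.Nonsep (S ∪ S') := by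
  refine ⟨h.nonempty.mono Set.subset_union_left, Set.union_subset h.subset h'.subset,
    h.conn.union h'.conn hu.1 hu.2, fun w => ?_⟩
  rw [Set.union_sdiff_distrib]
  by_cases hw : u = w
  · subst hw
    exact (h.conn_diff u).union (h'.conn_diff u) ⟨hv.1, huv.symm⟩ ⟨hv.2, huv.symm⟩
  · exact (h.conn_diff w).union (h'.conn_diff w) ⟨hu.1, hw⟩ ⟨hu.2, hw⟩

theorem finite_Iic (D : FinDigraph α) : {B : FinDigraph α | B ≤ D}.Finite := by
  have hf : ((𝒫 D.verts) ×ˢ (𝒫 (D.verts ×ˢ D.verts))).Finite :=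
    (D.finite_verts.finite_subsets).prod (D.finite_verts.prod D.finite_verts).finite_subsets
  refine Set.Finite.of_finite_image (f := fun B => (B.verts, {p : α × α | B.Arc p.1 p.2}))
    (hf.subset ?_) ?_
  · rintro _ ⟨B, hB, rfl⟩
    refine ⟨hB.1, ?_⟩
    rintro ⟨x, y⟩ h
    exact ⟨hB.1 (B.left_mem h), hB.1 (B.right_mem h)⟩
  · rintro B - B' - h
    simp only [Prod.mk.injEq] at h
    ext x y
    · rw [h.1]
    · exact Set.ext_iff.1 h.2 (x, y)

theorem Nonsep.exists_block (h : D.Nonsep S) : ∃ B, D.IsBlock B ∧ S ⊆ B.verts := by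
  have hf : {B' : FinDigraph α | B' ≤ D ∧ B'.IsConnected ∧ ∀ v, ¬ B'.IsSeparatingVertex v}.Finite :=
    D.finite_Iic.subset fun B hB => hB.1
  obtain ⟨B, hle, hB⟩ := hf.exists_le_maximal (a := D.induce S) h.induce
  exact ⟨B, hB, fun x hx => hle.1 ⟨h.subset hx, hx⟩⟩

theorem IsBlock.nonsep (hB : D.IsBlock B) : D.Nonsep B.verts :=
  Nonsep.of_le hB.prop.1 hB.prop.2.1 hB.prop.2.2

theorem IsBlock.subset_of_nonsep (hB : D.IsBlock B) (hS : D.Nonsep S) (hsub : B.verts ⊆ S) :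
    S ⊆ B.verts := by
  have h1 : B ≤ D.induce S := ⟨fun x hx => ⟨hB.prop.1.1 hx, hsub hx⟩, fun x y hxy =>
    ⟨hB.prop.1.2 x y hxy, hsub (B.left_mem hxy), hsub (B.right_mem hxy)⟩⟩
  exact fun x hx => (hB.le_of_ge hS.induce h1).1 ⟨hS.subset hx, hx⟩

/-- Adding arcs on the same vertices preserves nonseparability, so maximality makes blocks induced.
-/
theorem IsBlock.arc_iff (hB : D.IsBlock B) :
    B.Arc u v ↔ D.Arc u v ∧ u ∈ B.verts ∧ v ∈ B.verts := by
  have h1 : B ≤ D.induce B.verts := ⟨fun x hx => ⟨hB.prop.1.1 hx, hx⟩, fun x y hxy =>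
    ⟨hB.prop.1.2 x y hxy, B.left_mem hxy, B.right_mem hxy⟩⟩
  exact ⟨fun h => h1.2 u v h, fun h => (hB.le_of_ge hB.nonsep.induce h1).2 u v h⟩

theorem IsBlock.nonsep_subset (hB : D.IsBlock B) (hS : D.Nonsep S)
    (hu : u ∈ B.verts ∩ S) (hv : v ∈ B.verts ∩ S) (huv : u ≠ v) : S ⊆ B.verts :=
  Set.subset_union_right.trans
    (hB.subset_of_nonsep (hB.nonsep.union hS hu hv huv) Set.subset_union_left)

theorem IsBlock.eq_of_two_mem {B' : FinDigraph α} (hB : D.IsBlock B) (hB' : D.IsBlock B')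
    (hu : u ∈ B.verts) (hu' : u ∈ B'.verts) (hv : v ∈ B.verts) (hv' : v ∈ B'.verts)
    (huv : u ≠ v) : B = B' := by
  have h1 := hB.nonsep_subset hB'.nonsep ⟨hu, hu'⟩ ⟨hv, hv'⟩ huv
  have h2 := hB'.nonsep_subset hB.nonsep ⟨hu', hu⟩ ⟨hv', hv⟩ huv
  have h3 := h2.antisymm h1
  ext x y
  · rw [h3]
  · rw [hB.arc_iff, hB'.arc_iff, h3]

/-- Removing `f k` leaves a path on which every vertex can walk forward to `f (k - 1)`. -/
theorem nonsep_range_cycle {n : ℕ} [NeZero n] {f : ZMod n → α} (hf : Function.Injective f)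
    (hD : ∀ i, f i ∈ D.verts) (h : ∀ i, D.Arc (f i) (f (i + 1)) ∨ D.Arc (f (i + 1)) (f i)) :
    D.Nonsep (Set.range f) := by
  have hdiff : ∀ k, D.ConnOn (Set.range f \ {f k}) := by
    intro k
    refine connOn_of_forall (v := f (k - 1)) ?_
    rintro _ ⟨⟨j, rfl⟩, hj⟩
    have hjk : j ≠ k := fun e => hj (by rw [e]; rfl)
    have := ZMod.forward_induction (j := j) (k := k)
      (P := fun i => i ≠ k ∧ ReflTransGen (D.AdjOn (Set.range f \ {f k})) (f j) (f i))
      ⟨hjk, .refl⟩ (fun i hi hk => ⟨hk, hi.2.tail ⟨⟨⟨i, rfl⟩, fun e => hi.1 (hf e)⟩,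
        ⟨⟨i + 1, rfl⟩, fun e => hk (hf e)⟩, h i⟩⟩)
    exact this.2
  have hconn : D.ConnOn (Set.range f) := by
    have key : ∀ m : ℕ, ReflTransGen (D.AdjOn (Set.range f)) (f 0) (f (m : ZMod n)) := by
      intro m
      induction m with
      | zero => simpa using ReflTransGen.refl
      | succ m ih =>
        push_cast
        exact ih.tail ⟨⟨_, rfl⟩, ⟨_, rfl⟩, h _⟩
    refine connOn_of_forall (v := f 0) ?_
    rintro _ ⟨j, rfl⟩
    simpa using reflTransGen_adjOn_symm (key j.val)
  refine ⟨⟨f 0, 0, rfl⟩, by rintro _ ⟨i, rfl⟩; exact hD i, hconn, fun v => ?_⟩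
  by_cases hv : v ∈ Set.range f
  · obtain ⟨k, rfl⟩ := hv; exact hdiff k
  · rwa [Set.sdiff_singleton_eq_self hv]

/-- A walk between two neighbours of `v` that avoids `v` yields a cycle through `v`. -/
theorem exists_cycle_of_adj (hu : D.Arc v u ∨ D.Arc u v) (hw : D.Arc v w ∨ D.Arc w v)
    (hvS : v ∉ S) (huS : u ∈ S) (h : ReflTransGen (D.AdjOn S) u w) :
    ∃ (n : ℕ) (_ : NeZero n) (f : ZMod n → α), Function.Injective f ∧ f 0 = v ∧ f 1 = u ∧
      f (-1) = w ∧ (∀ i, i ≠ 0 → f i ∈ S) ∧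
      ∀ i, D.Arc (f i) (f (i + 1)) ∨ D.Arc (f (i + 1)) (f i) := by
  -- In `r` the only step out of `v` leads to `u` and the only step into `v` comes from `w`, so a
  -- shortest closed walk through `v` has the required neighbors. The case `u = w` gives length two.
  let r : α → α → Prop := fun a b =>
    (a = v ∧ b = u) ∨ (a = w ∧ b = v) ∨ D.AdjOn S a b
  have h' : ReflTransGen r u w := ReflTransGen.lift (p := r) id (fun _ _ hab => Or.inr (Or.inr hab)) _ _ h
  have hr : TransGen r v v :=
    TransGen.head' (Or.inl ⟨rfl, rfl⟩) (h'.tail (Or.inr (Or.inl ⟨rfl, rfl⟩)))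
  obtain ⟨n, hn, f, hf, h0, hs⟩ := hr.exists_cycle
  have huv : u ≠ v := fun e => hvS (e ▸ huS)
  have hwv : w ≠ v := by
    rintro rfl
    exact hw.elim (D.loopless _) (D.loopless _)
  have h1 : f 1 = u := by
    have := hs 0
    rw [zero_add, h0] at this
    rcases this with h | h | h
    · exact h.2
    · exact absurd h.1.symm hwv
    · exact absurd h.1 hvS
  have h2 : f (-1) = w := by
    have := hs (-1)
    rw [neg_add_cancel, h0] at this
    rcases this with h | h | h
    · exact absurd h.2.symm huv
    · exact h.1
    · exact absurd h.2.1 hvS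
  refine ⟨n, hn, f, hf, h0, h1, h2, fun i hi => ?_, fun i => ?_⟩
  · have hiv : f i ≠ v := fun e => hi (hf (e.trans h0.symm))
    have := hs (i - 1)
    rw [sub_add_cancel] at this
    rcases this with h | h | h
    · rw [h.2]; exact huS
    · exact absurd h.2 hiv
    · exact h.2.1
  · rcases hs i with h | h | h
    · rw [h.1, h.2]; exact hu
    · rw [h.1, h.2]; exact hw.symm
    · exact h.2.2

/-- Neighbors of `v` in the same component of `D - v` share a block with `v`. With `u = w` and the
trivial walk this places a single arc in a block. -/
theorem exists_block_of_walk (hu : D.Arc v u ∨ D.Arc u v) (hw : D.Arc v w ∨ D.Arc w v)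
    (h : ReflTransGen (D.AdjOn (D.verts \ {v})) u w) :
    ∃ B, D.IsBlock B ∧ v ∈ B.verts ∧ u ∈ B.verts ∧ w ∈ B.verts := by
  have hvD : v ∈ D.verts := hu.elim D.left_mem D.right_mem
  have huD : u ∈ D.verts := hu.elim D.right_mem D.left_mem
  have huv : u ≠ v := hu.elim (fun h => (ne_of_arc h).symm) ne_of_arc
  obtain ⟨n, hn, f, hf, h0, h1, h2, h3, h4⟩ :=
    exists_cycle_of_adj hu hw (S := D.verts \ {v}) (fun h => h.2 rfl) ⟨huD, huv⟩ h
  have hns : D.Nonsep (Set.range f) := by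
    refine nonsep_range_cycle hf (fun i => ?_) h4
    by_cases hi : i = 0
    · rw [hi, h0]; exact hvD
    · exact (h3 i hi).1
  obtain ⟨B, hB, hsub⟩ := hns.exists_block
  exact ⟨B, hB, hsub ⟨0, h0⟩, hsub ⟨1, h1⟩, hsub ⟨-1, h2⟩⟩

end FinDigraph

/-- A relation between finite sets `A` and `N` with `|N| ≤ |A|` that is total on `A` and injective
is a bijection. -/
theorem Set.bijective_rel_of_ncard_le {α β : Type*} {A : Set β} {N : Set α} {P : β → α → Prop}
    (hN : N.Finite) (hle : N.ncard ≤ A.ncard) (h1 : ∀ x ∈ A, ∃ w ∈ N, P x w)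
    (h2 : ∀ w ∈ N, ∀ x ∈ A, ∀ x' ∈ A, P x w → P x' w → x = x') :
    (∀ x ∈ A, ∀ w ∈ N, ∀ w' ∈ N, P x w → P x w' → w = w') ∧ ∀ w ∈ N, ∃ x ∈ A, P x w := by
  classical
  -- A choice function for `P` is injective, hence onto by counting. Applied to one with value `w'`
  -- at `x`, this gives a `y` with value `w`, and injectivity of `P` forces `y = x`.
  have key : ∀ o : A → α, (∀ x : A, o x ∈ N ∧ P x (o x)) → ∀ w ∈ N, ∃ x : A, o x = w := by
    intro o ho w hw
    have hinj : Function.Injective o := fun x y hxy =>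
      Subtype.ext (h2 _ (ho x).1 x x.2 y y.2 (ho x).2 (hxy ▸ (ho y).2))
    have hsub : Set.range o ⊆ N := by rintro _ ⟨x, rfl⟩; exact (ho x).1
    have hcard : (Set.range o).ncard = A.ncard := by
      rw [← Set.image_univ, Set.ncard_image_of_injective _ hinj, Set.ncard_univ]
      rfl
    have := Set.eq_of_subset_of_ncard_le hsub (by omega) hN
    exact (this.symm ▸ hw : w ∈ Set.range o)
  choose o ho using fun x : A => h1 x x.2
  refine ⟨fun x hx w hw w' hw' hP hP' => ?_, fun w hw => ?_⟩
  · by_contra hne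
    obtain ⟨y, hy⟩ := key (Function.update o ⟨x, hx⟩ w') (fun y => by
      by_cases hyx : y = ⟨x, hx⟩
      · subst hyx; simpa using ⟨hw', hP'⟩
      · simpa [hyx] using ho y) w hw
    by_cases hyx : y = ⟨x, hx⟩
    · subst hyx; simp at hy; exact hne hy.symm
    · have h3 : o y = w := by simpa [hyx] using hy
      exact hyx (Subtype.ext (h2 w hw y y.2 x hx (h3 ▸ (ho y).2) hP))
  · obtain ⟨y, hy⟩ := key o ho w hw
    exact ⟨y, y.2, hy ▸ (ho y).2⟩

/-! ### Covers, holes and their movement. -/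

namespace DigraphCover

variable {α β : Type*} {D : FinDigraph α} {C : DigraphCover D β} {a b u v w : α} {x y x' y' : β}
  {t t' : α → β} {S : Set α}

theorem mem_verts_of_mem (hx : x ∈ C.X v) : v ∈ D.verts := by
  by_contra h
  rw [C.X_eq_empty v h] at hx
  exact hx

theorem eq_of_mem (hx : x ∈ C.X u) (hx' : x ∈ C.X v) : u = v := by
  by_contra h
  exact Set.disjoint_left.1
    (C.disjoint u (mem_verts_of_mem hx) v (mem_verts_of_mem hx') h) hx hx'

theorem mem_H_verts (hx : x ∈ C.X v) : x ∈ C.H.verts := by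
  rw [C.verts_eq]
  exact Set.mem_biUnion (mem_verts_of_mem hx) hx

theorem finite_X (C : DigraphCover D β) (v : α) : (C.X v).Finite :=
  C.H.finite_verts.subset fun _ hx => mem_H_verts hx

theorem arc_of_mem (h : C.H.Arc x y) (hx : x ∈ C.X u) (hy : y ∈ C.X v) : D.Arc u v := by
  obtain ⟨u', v', h1, h2, h3⟩ := C.arc x y h
  rwa [eq_of_mem hx h2, eq_of_mem hy h3]

theorem eq_left_of_arc (h : C.H.Arc x y) (h' : C.H.Arc x' y) (hx : x ∈ C.X u) (hx' : x' ∈ C.X u)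
    (hy : y ∈ C.X v) : x = x' := by
  by_contra hne
  exact (C.matching u v (arc_of_mem h hx hy) (x, y) ⟨h, hx, hy⟩ (x', y) ⟨h', hx', hy⟩
    (by simpa using hne)).2.2.2 rfl

theorem eq_right_of_arc (h : C.H.Arc x y) (h' : C.H.Arc x y') (hx : x ∈ C.X u) (hy : y ∈ C.X v)
    (hy' : y' ∈ C.X v) : y = y' := by
  by_contra hne
  exact (C.matching u v (arc_of_mem h hx hy) (x, y) ⟨h, hx, hy⟩ (x, y') ⟨h', hx, hy'⟩
    (by simpa using hne)).1 rfl

/-- The arc relation of `H` between the colors chosen by `t` for the vertices in `S`. -/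
def Rel (C : DigraphCover D β) (S : Set α) (t : α → β) (a b : α) : Prop :=
  a ∈ S ∧ b ∈ S ∧ C.H.Arc (t a) (t b)

/-- A transversal has one color per vertex, so directed cycles of `H[T]` can be treated as closed
walks of `Rel` on vertices of `D`; `not_transGen_of_isAcyclic` is the other direction. -/
theorem exists_transGen (hC : ¬ C.IsColorable) (ht : ∀ u ∈ D.verts, t u ∈ C.X u) :
    ∃ a, TransGen (C.Rel D.verts t) a a := by
  by_contra! hno
  refine hC ⟨t '' D.verts, ⟨?_, fun v hv => ?_⟩, ?_⟩
  · rintro _ ⟨u, hu, rfl⟩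
    exact mem_H_verts (ht u hu)
  · rw [Set.ncard_eq_one]
    refine ⟨t v, Set.Subset.antisymm ?_ ?_⟩
    · rintro _ ⟨⟨u, hu, rfl⟩, h2⟩
      rw [eq_of_mem (ht u hu) h2]
      rfl
    · rintro _ rfl
      exact ⟨⟨v, hv, rfl⟩, ht v hv⟩
  · rintro K n hK ⟨hn, f, -, -, hf⟩
    have : NeZero n := ⟨by omega⟩
    have h1 : ∀ i, C.H.Arc (f i) (f (i + 1)) ∧ f i ∈ t '' D.verts := fun i =>
      ⟨(hK.2 _ _ ((hf _ _).2 ⟨i, rfl, rfl⟩)).1, (hK.2 _ _ ((hf _ _).2 ⟨i, rfl, rfl⟩)).2.1⟩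
    choose g hg using fun i => (h1 i).2
    refine hno (g 0) (transGen_of_cycle (f := g) (fun i => ⟨(hg i).1, (hg _).1, ?_⟩) 0)
    rw [(hg i).2, (hg (i + 1)).2]
    exact (h1 i).1

theorem not_transGen_of_isAcyclic {T : Set β} (hT : (C.H.induce T).IsAcyclic)
    (ht : ∀ u ∈ D.verts, t u ∈ C.X u ∧ t u ∈ T) (a : α) : ¬ TransGen (C.Rel D.verts t) a a := by
  intro h
  obtain ⟨n, hn, f, hf, -, hs⟩ := h.exists_cycle
  have hinj : Function.Injective fun i => t (f i) := fun i j hij =>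
    hf (eq_of_mem (ht _ (hs i).1).1 (by
      have := (ht _ (hs j).1).1
      rwa [← show t (f i) = t (f j) from hij] at this))
  let K : FinDigraph β :=
    { verts := Set.range fun i => t (f i)
      finite_verts := Set.finite_range _
      Arc := fun u v => ∃ i, u = t (f i) ∧ v = t (f (i + 1))
      left_mem := by rintro _ _ ⟨i, rfl, rfl⟩; exact ⟨i, rfl⟩
      right_mem := by rintro _ _ ⟨i, rfl, rfl⟩; exact ⟨i + 1, rfl⟩
      loopless := by
        rintro v ⟨i, h1, h2⟩
        have := (hs i).2.2
        rw [← h1, ← h2] at this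
        exact C.H.loopless _ this }
  refine hT K n ⟨?_, ?_⟩ ⟨?_, fun i => t (f i), hinj, rfl, fun u v => Iff.rfl⟩
  · rintro _ ⟨i, rfl⟩
    exact ⟨mem_H_verts (ht _ (hs i).1).1, (ht _ (hs i).1).2⟩
  · rintro _ _ ⟨i, rfl, rfl⟩
    exact ⟨(hs i).2.2, (ht _ (hs i).1).2, (ht _ (hs (i + 1)).1).2⟩
  · by_contra hlt
    have h0 := NeZero.ne n
    obtain rfl : n = 1 := by omega
    have := (hs 0).2.2
    rw [Subsingleton.elim ((0 : ZMod 1) + 1) 0] at this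
    exact C.H.loopless _ this

/-- `t` is an acyclic transversal of the cover restricted to `D - v`. -/
structure Hole (C : DigraphCover D β) (v : α) (t : α → β) : Prop where
  mem : v ∈ D.verts
  color : ∀ u ∈ D.verts, u ≠ v → t u ∈ C.X u
  acyclic : ∀ a, ¬ TransGen (C.Rel (D.verts \ {v}) t) a a

/-- The value `t v` is irrelevant to a hole at `v`, so it may be overwritten at will. -/
theorem Hole.congr (h : C.Hole v t) (ht : ∀ u ∈ D.verts, u ≠ v → t' u = t u) : C.Hole v t' := by
  refine ⟨h.mem, fun u hu huv => by rw [ht u hu huv]; exact h.color u hu huv, fun a ha => ?_⟩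
  refine h.acyclic a (ha.lift id ?_)
  rintro p q ⟨h1, h2, h3⟩
  exact ⟨h1, h2, by rwa [ht p h1.1 h1.2, ht q h2.1 h2.2] at h3⟩

open Classical in
theorem Hole.update_self (h : C.Hole v t) (x : β) : C.Hole v (Function.update t v x) :=
  h.congr fun u _ huv => by rw [Function.update_of_ne huv]

/-- The standing assumption: a degree-feasible uncolorable configuration. -/
structure Bad (C : DigraphCover D β) : Prop where
  deg : C.IsDegreeFeasible
  unc : ¬ C.IsColorable

/-- The full coloring has a directed cycle, and without `v` there is none. -/
theorem Hole.transGen (hC : C.Bad) (h : C.Hole v t) (hx : t v ∈ C.X v) :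
    TransGen (C.Rel D.verts t) v v := by
  obtain ⟨a, ha⟩ := exists_transGen (t := t) hC.unc fun u hu => by
    by_cases huv : u = v
    · rwa [huv]
    · exact h.color u hu huv
  rcases ha.avoid_or_through v with h1 | h1
  · refine absurd (h1.lift id ?_) (h.acyclic a)
    rintro p q ⟨h1, h2, h3⟩
    exact ⟨⟨h1.1, h2⟩, ⟨h1.2.1, h3⟩, h1.2.2⟩
  · exact h1

theorem Hole.color_of_arc (h : C.Hole v t) (hw : D.Arc v w ∨ D.Arc w v) : t w ∈ C.X w :=
  hw.elim (fun h1 => h.color w (D.right_mem h1) (FinDigraph.ne_of_arc h1).symm)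
    fun h1 => h.color w (D.left_mem h1) (FinDigraph.ne_of_arc h1)

open Classical in
theorem Hole.exists_out (hC : C.Bad) (h : C.Hole v t) (hx : x ∈ C.X v) :
    ∃ w, D.Arc v w ∧ C.H.Arc x (t w) := by
  have h1 := (h.update_self x).transGen hC (by simpa using hx)
  obtain ⟨w, h2, -⟩ := TransGen.head'_iff.1 h1
  have h3 := h2.2.2
  have hwv : w ≠ v := by rintro rfl; exact C.H.loopless _ h3
  rw [Function.update_self, Function.update_of_ne hwv] at h3
  exact ⟨w, arc_of_mem h3 hx (h.color w h2.2.1 hwv), h3⟩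

open Classical in
theorem Hole.exists_in (hC : C.Bad) (h : C.Hole v t) (hx : x ∈ C.X v) :
    ∃ w, D.Arc w v ∧ C.H.Arc (t w) x := by
  have h1 := (h.update_self x).transGen hC (by simpa using hx)
  obtain ⟨w, -, h2⟩ := TransGen.tail'_iff.1 h1
  have h3 := h2.2.2
  have hwv : w ≠ v := by rintro rfl; exact C.H.loopless _ h3
  rw [Function.update_self, Function.update_of_ne hwv] at h3
  exact ⟨w, arc_of_mem h3 (h.color w h2.1 hwv) hx, h3⟩

/-- Each color of `v` is joined to the color of some out-neighbor, the matching condition makes this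
injective, and there are at least as many colors as out-neighbors. Counting leaves no slack. -/
theorem Hole.bijective_out (hC : C.Bad) (h : C.Hole v t) :
    (∀ x ∈ C.X v, ∀ w ∈ {w | D.Arc v w}, ∀ w' ∈ {w | D.Arc v w},
      C.H.Arc x (t w) → C.H.Arc x (t w') → w = w') ∧
      ∀ w ∈ {w | D.Arc v w}, ∃ x ∈ C.X v, C.H.Arc x (t w) :=
  Set.bijective_rel_of_ncard_le (P := fun x w => C.H.Arc x (t w))
    (D.finite_verts.subset fun _ hw => D.right_mem hw)
    ((le_max_left _ _).trans (hC.deg.2 v h.mem)) (fun _ hx => h.exists_out hC hx)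
    fun _ hw _ hx _ hx' h1 h2 => eq_left_of_arc h1 h2 hx hx' (h.color_of_arc (.inl hw))

theorem Hole.bijective_in (hC : C.Bad) (h : C.Hole v t) :
    (∀ x ∈ C.X v, ∀ w ∈ {w | D.Arc w v}, ∀ w' ∈ {w | D.Arc w v},
      C.H.Arc (t w) x → C.H.Arc (t w') x → w = w') ∧
      ∀ w ∈ {w | D.Arc w v}, ∃ x ∈ C.X v, C.H.Arc (t w) x :=
  Set.bijective_rel_of_ncard_le (P := fun x w => C.H.Arc (t w) x)
    (D.finite_verts.subset fun _ hw => D.left_mem hw)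
    ((le_max_right _ _).trans (hC.deg.2 v h.mem)) (fun _ hx => h.exists_in hC hx)
    fun _ hw _ hx _ hx' h1 h2 => eq_right_of_arc h1 h2 (h.color_of_arc (.inr hw)) hx hx'

theorem Hole.out_unique (hC : C.Bad) (h : C.Hole v t) (hx : x ∈ C.X v) (hw : D.Arc v w)
    (hu : D.Arc v u) (h1 : C.H.Arc x (t w)) (h2 : C.H.Arc x (t u)) : w = u :=
  (h.bijective_out hC).1 x hx w hw u hu h1 h2

theorem Hole.in_unique (hC : C.Bad) (h : C.Hole v t) (hx : x ∈ C.X v) (hw : D.Arc w v)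
    (hu : D.Arc u v) (h1 : C.H.Arc (t w) x) (h2 : C.H.Arc (t u) x) : w = u :=
  (h.bijective_in hC).1 x hx w hw u hu h1 h2

theorem Hole.exists_color_out (hC : C.Bad) (h : C.Hole v t) (hw : D.Arc v w) :
    ∃ x ∈ C.X v, C.H.Arc x (t w) :=
  (h.bijective_out hC).2 w hw

theorem Hole.exists_color_in (hC : C.Bad) (h : C.Hole v t) (hw : D.Arc w v) :
    ∃ x ∈ C.X v, C.H.Arc (t w) x :=
  (h.bijective_in hC).2 w hw

/-- If the vertex `v` gets a color adjacent to the color of `w`, then `w` can be uncolored. -/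
theorem Hole.slide_full (hC : C.Bad) (h : C.Hole v t) (hx : t v ∈ C.X v)
    (hw : D.Arc v w ∧ C.H.Arc (t v) (t w) ∨ D.Arc w v ∧ C.H.Arc (t w) (t v)) : C.Hole w t := by
  have hfull : ∀ u ∈ D.verts, t u ∈ C.X u := fun u hu => by
    by_cases huv : u = v
    · rwa [huv]
    · exact h.color u hu huv
  refine ⟨hw.elim (fun h => D.right_mem h.1) (fun h => D.left_mem h.1),
    fun u hu _ => hfull u hu, fun a ha => ?_⟩
  rcases ha.avoid_or_through v with h1 | h1
  · refine absurd (h1.lift id ?_) (h.acyclic a)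
    rintro p q ⟨h1, h2, h3⟩
    exact ⟨⟨h1.1.1, h2⟩, ⟨h1.2.1.1, h3⟩, h1.2.2⟩
  -- A closed walk through `v` would have to use `w`, the only neighbor in that direction joined to
  -- `v` in color, but `w` has been removed.
  · rcases hw with hw | hw
    · obtain ⟨p, h2, -⟩ := TransGen.head'_iff.1 h1
      exact h2.2.1.2 (h.out_unique hC hx (arc_of_mem h2.2.2 hx (hfull p h2.2.1.1)) hw.1
        h2.2.2 hw.2)
    · obtain ⟨p, -, h2⟩ := TransGen.tail'_iff.1 h1
      exact h2.1.2 (h.in_unique hC hx (arc_of_mem h2.2.2 (hfull p h2.1.1) hx) hw.1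
        h2.2.2 hw.2)

open Classical in
theorem Hole.slide (hC : C.Bad) (h : C.Hole v t) (hx : x ∈ C.X v)
    (hw : D.Arc v w ∧ C.H.Arc x (t w) ∨ D.Arc w v ∧ C.H.Arc (t w) x) :
    C.Hole w (Function.update t v x) := by
  have hwv : w ≠ v := hw.elim (fun h => (FinDigraph.ne_of_arc h.1).symm)
    fun h => FinDigraph.ne_of_arc h.1
  exact (h.update_self x).slide_full hC (by simpa) (by simpa [hwv])

theorem Hole.exists_color (hC : C.Bad) (h : C.Hole v t) (hw : D.Arc v w ∨ D.Arc w v) :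
    ∃ x ∈ C.X v, D.Arc v w ∧ C.H.Arc x (t w) ∨ D.Arc w v ∧ C.H.Arc (t w) x := by
  rcases hw with hw | hw
  · obtain ⟨x, hx, h1⟩ := h.exists_color_out hC hw
    exact ⟨x, hx, .inl ⟨hw, h1⟩⟩
  · obtain ⟨x, hx, h1⟩ := h.exists_color_in hC hw
    exact ⟨x, hx, .inr ⟨hw, h1⟩⟩

/-- The uncolored vertex can be moved along any walk of the underlying graph. -/
theorem Hole.slide_walk (hC : C.Bad) (h : C.Hole a t) (hab : ReflTransGen (D.AdjOn S) a b) :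
    ∃ t', C.Hole b t' ∧ ∀ c, c ∉ S → t' c = t c := by
  classical
  induction hab with
  | refl => exact ⟨t, h, fun _ _ => rfl⟩
  | tail _ hbc ih =>
    rename_i b c _
    obtain ⟨t', h1, h2⟩ := ih
    obtain ⟨x, hx, h3⟩ := h1.exists_color hC hbc.2.2
    refine ⟨_, h1.slide hC hx h3, fun d hd => ?_⟩
    rw [Function.update_of_ne (by rintro rfl; exact hd hbc.1), h2 d hd]

theorem Hole.exists_hole (hC : C.Bad) (h : C.Hole a t) (hb : b ∈ D.verts) : ∃ t', C.Hole b t' := by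
  obtain ⟨t', h1, -⟩ := h.slide_walk hC
    ((FinDigraph.isConnected_iff.1 hC.deg.1).2 a h.mem b hb)
  exact ⟨t', h1⟩

/-- In a minimal uncolorable configuration, each arc of `H` closes a directed cycle with some
acyclic transversal of the rest. -/
theorem exists_hole_of_arc (hC : C.Bad) (hmin : C.IsMinimalUncolorable) (hxy : C.H.Arc x y) :
    ∃ u v t, t u = x ∧ t v = y ∧ D.Arc u v ∧ (∀ w ∈ D.verts, t w ∈ C.X w) ∧
      C.Hole u t ∧ C.Hole v t := by
  classical
  obtain ⟨T, hT, hac⟩ := hmin.2.2 x y hxy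
  have h1 : ∀ w : α, ∃ z, w ∈ D.verts → T ∩ C.X w = {z} := fun w => by
    by_cases hw : w ∈ D.verts
    · obtain ⟨z, hz⟩ := Set.ncard_eq_one.1 (hT.2 w hw)
      exact ⟨z, fun _ => hz⟩
    · exact ⟨x, fun h => absurd h hw⟩
  choose t ht using h1
  have h2 : ∀ w ∈ D.verts, t w ∈ C.X w ∧ t w ∈ T := fun w hw => by
    have : t w ∈ T ∩ C.X w := by rw [ht w hw]; rfl
    exact this.symm
  have h3 := not_transGen_of_isAcyclic (C := C.deleteArc x y) hac h2
  have hinj : ∀ p ∈ D.verts, ∀ q ∈ D.verts, t p = t q → p = q := fun p hp q hq he =>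
    eq_of_mem (h2 p hp).1 (he ▸ (h2 q hq).1)
  -- A transversal missing an end of the deleted arc would be acyclic in `H` as well.
  have h4 : ∃ u ∈ D.verts, ∃ v ∈ D.verts, t u = x ∧ t v = y := by
    by_contra! hno
    obtain ⟨a, ha⟩ := exists_transGen hC.unc fun u hu => (h2 u hu).1
    refine h3 a (ha.lift id ?_)
    rintro p q ⟨hp, hq, hpq⟩
    exact ⟨hp, hq, hpq, fun he => hno p hp q hq he.1 he.2⟩
  obtain ⟨u, hu, v, hv, rfl, rfl⟩ := h4
  refine ⟨u, v, t, rfl, rfl, arc_of_mem hxy (h2 u hu).1 (h2 v hv).1, fun w hw => (h2 w hw).1,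
    ⟨hu, fun w hw _ => (h2 w hw).1, fun a ha => h3 a (ha.lift id ?_)⟩,
    ⟨hv, fun w hw _ => (h2 w hw).1, fun a ha => h3 a (ha.lift id ?_)⟩⟩
  · rintro p q ⟨hp, hq, hpq⟩
    exact ⟨hp.1, hq.1, hpq, fun he => hp.2 (hinj _ hp.1 _ hu he.1)⟩
  · rintro p q ⟨hp, hq, hpq⟩
    exact ⟨hp.1, hq.1, hpq, fun he => hq.2 (hinj _ hq.1 _ hv he.2)⟩

/-- Either every vertex can be left uncolored by an acyclic transversal of the rest, or `D` is a
single vertex without colors. -/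
theorem exists_hole_or_isolated (hC : C.Bad) (hmin : C.IsMinimalUncolorable) (hv : v ∈ D.verts) :
    (∃ t, C.Hole v t) ∨ C.X v = ∅ ∧ ∀ w, ¬ D.Arc v w ∧ ¬ D.Arc w v := by
  by_cases hH : ∃ x y, C.H.Arc x y
  · obtain ⟨x, y, hxy⟩ := hH
    obtain ⟨u, -, t, -, -, -, -, h, -⟩ := exists_hole_of_arc hC hmin hxy
    exact .inl (h.exists_hole hC hv)
  · push Not at hH
    right
    -- Without arcs in `H` any transversal is acyclic, so uncolorability must come from an empty
    -- color set; degree feasibility then isolates its vertex.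
    have h1 : ∃ u ∈ D.verts, C.X u = ∅ := by
      by_contra! hne
      obtain ⟨z, -⟩ := hne v hv
      have h1 : ∀ w : α, ∃ z, w ∈ D.verts → z ∈ C.X w := fun w => by
        by_cases hw : w ∈ D.verts
        · obtain ⟨z, hz⟩ := hne w hw
          exact ⟨z, fun _ => hz⟩
        · exact ⟨z, fun h => absurd h hw⟩
      choose t ht using h1
      obtain ⟨a, ha⟩ := exists_transGen hC.unc ht
      obtain ⟨b, h2, -⟩ := TransGen.head'_iff.1 ha
      exact hH _ _ h2.2.2
    obtain ⟨u, hu, hXu⟩ := h1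
    have hdeg := hC.deg.2 u hu
    rw [hXu, Set.ncard_empty, Nat.le_zero, Nat.max_eq_zero_iff] at hdeg
    have hout : {w | D.Arc u w} = ∅ :=
      (Set.ncard_eq_zero (D.finite_verts.subset fun _ hw => D.right_mem hw)).1 hdeg.1
    have hin : {w | D.Arc w u} = ∅ :=
      (Set.ncard_eq_zero (D.finite_verts.subset fun _ hw => D.left_mem hw)).1 hdeg.2
    have hiso : ∀ w, ¬ D.Arc u w ∧ ¬ D.Arc w u := fun w =>
      ⟨fun h => Set.eq_empty_iff_forall_notMem.1 hout w h,
        fun h => Set.eq_empty_iff_forall_notMem.1 hin w h⟩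
    have huv : u = v := by
      rcases ReflTransGen.cases_head ((FinDigraph.isConnected_iff.1 hC.deg.1).2 u hu v hv) with
        h | ⟨w, h, -⟩
      · exact h
      · exact absurd h.2.2 (by simpa using hiso w)
    subst huv
    exact ⟨hXu, hiso⟩

end DigraphCover

/-! ### Color cycles and directed-cycle blocks. -/

namespace DigraphCover

variable {α β : Type*} {D B : FinDigraph α} {C : DigraphCover D β} {a b u v w : α} {x y x' y' : β}
  {t t' : α → β} {S : Set α}

open Classical in
theorem Hole.update_full (h : C.Hole v t) (hx : x ∈ C.X v) :
    ∀ u ∈ D.verts, Function.update t v x u ∈ C.X u := fun u hu => by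
  by_cases huv : u = v
  · subst huv; simpa
  · rw [Function.update_of_ne huv]; exact h.color u hu huv

/-- A directed cycle in the colors chosen by a transversal `t`, where each vertex of the cycle may
be uncolored to break all directed cycles. -/
structure ColorCycle (C : DigraphCover D β) (t : α → β) {n : ℕ} (f : ZMod n → α) : Prop where
  full : ∀ u ∈ D.verts, t u ∈ C.X u
  inj : Function.Injective f
  arc : ∀ i, C.H.Arc (t (f i)) (t (f (i + 1)))
  hole : ∀ i, C.Hole (f i) t

/-- The full coloring stays fixed while the role of the hole slides along the closed cycle to each
of its vertices. -/
theorem Hole.exists_colorCycle (hC : C.Bad) (h : C.Hole v t) (ht : ∀ u ∈ D.verts, t u ∈ C.X u) :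
    ∃ (n : ℕ) (_ : NeZero n) (f : ZMod n → α), f 0 = v ∧ C.ColorCycle t f := by
  obtain ⟨n, hn, f, hf, h0, hs⟩ := (h.transGen hC (ht v h.mem)).exists_cycle
  refine ⟨n, hn, f, h0, ht, hf, fun i => (hs i).2.2, ?_⟩
  have key : ∀ m : ℕ, C.Hole (f (m : ZMod n)) t := by
    intro m
    induction m with
    | zero => simpa [h0] using h
    | succ m ih =>
      push_cast
      have h1 := hs (m : ZMod n)
      exact ih.slide_full hC (ht _ h1.1)
        (.inl ⟨arc_of_mem h1.2.2 (ht _ h1.1) (ht _ h1.2.1), h1.2.2⟩)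
  intro i
  simpa using key i.val

namespace ColorCycle

variable {n : ℕ} {f : ZMod n → α}

theorem digraph_arc (h : C.ColorCycle t f) (i : ZMod n) : D.Arc (f i) (f (i + 1)) :=
  arc_of_mem (h.arc i) (h.full _ (h.hole i).mem) (h.full _ (h.hole (i + 1)).mem)

theorem mem (h : C.ColorCycle t f) (i : ZMod n) : t (f i) ∈ C.X (f i) := h.full _ (h.hole i).mem

theorem nonsep [NeZero n] (h : C.ColorCycle t f) : D.Nonsep (Set.range f) :=
  FinDigraph.nonsep_range_cycle h.inj (fun i => (h.hole i).mem) fun i => .inl (h.digraph_arc i)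

theorem eq_next (hC : C.Bad) (h : C.ColorCycle t f) {i : ZMod n} (hb : D.Arc (f i) b)
    (h1 : C.H.Arc (t (f i)) (t b)) : b = f (i + 1) :=
  (h.hole i).out_unique hC (h.mem i) hb (h.digraph_arc i) h1 (h.arc i)

theorem eq_prev (hC : C.Bad) (h : C.ColorCycle t f) {i : ZMod n} (hb : D.Arc b (f i))
    (h1 : C.H.Arc (t b) (t (f i))) : b = f (i - 1) := by
  have h2 := h.arc (i - 1)
  have h3 := h.digraph_arc (i - 1)
  rw [sub_add_cancel] at h2 h3
  exact (h.hole i).in_unique hC (h.mem i) hb h3 h1 h2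

/-- The vertices of a color cycle induce a directed cycle in `D`. -/
theorem chordless (hC : C.Bad) (h : C.ColorCycle t f) {i j : ZMod n}
    (hij : D.Arc (f i) (f j)) : j = i + 1 := by
  classical
  by_contra hne
  have hji : j ≠ i := by rintro rfl; exact D.loopless _ hij
  obtain ⟨y, hy, hyj⟩ := (h.hole i).exists_color_out hC hij
  have hyi : y ≠ t (f i) := by
    rintro rfl
    exact hne (h.inj (h.eq_next hC hij hyj))
  have h1 : C.Hole (f i) (Function.update t (f i) y) := (h.hole i).update_self y
  have hfull := (h.hole i).update_full hy
  have hup : ∀ u, u ≠ f i → Function.update t (f i) y u = t u := fun u hu =>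
    Function.update_of_ne hu _ _
  have hupi : Function.update t (f i) y (f i) = y := Function.update_self _ _ _
  generalize Function.update t (f i) y = t' at *
  have hfne : ∀ k, k ≠ i → f k ≠ f i := fun k hk e => hk (h.inj e)
  -- With `f i` recolored by `y`, a walk from `f j` is forced to follow the old cycle and can never
  -- re-enter `f i`, although `y` must lie on a directed cycle.
  have key : ∀ b, ReflTransGen (C.Rel D.verts t') (f j) b →
      ∃ k, b = f k ∧ k ≠ i ∧ C.Hole b t' := by
    intro b hb
    induction hb with
    | refl =>
      exact ⟨j, rfl, hji, h1.slide_full hC (hfull _ h1.mem)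
        (.inl ⟨hij, by rwa [hupi, hup _ (hfne j hji)]⟩)⟩
    | tail _ hs ih =>
      rename_i b _
      obtain ⟨k, rfl, hk, h2⟩ := ih
      obtain ⟨hk1, hb1, hs⟩ := hs
      have hD := arc_of_mem hs (hfull _ hk1) (hfull _ hb1)
      have h3 := h2.slide_full hC (hfull _ hk1) (.inl ⟨hD, hs⟩)
      have harc := h.arc k
      have htk := hup _ (hfne k hk)
      by_cases hbi : b = f i
      · exfalso
        subst hbi
        rw [hupi, htk] at hs
        -- Entering `y` from `f (i - 1)` violates the matching with `t (f i)`; entering it from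
        -- elsewhere gives a second out-neighbor in color.
        by_cases hk2 : k + 1 = i
        · rw [hk2] at harc
          exact hyi (eq_right_of_arc hs harc (h.mem k) hy (h.mem i))
        · refine hk2 (h.inj (h2.out_unique hC (hfull _ hk1) (h.digraph_arc k) hD ?_ ?_))
          · rwa [htk, hup _ (hfne _ hk2)]
          · rwa [htk, hupi]
      · rw [htk, hup _ hbi] at hs
        obtain rfl := h.eq_next hC hD hs
        exact ⟨k + 1, rfl, fun e => hbi (by rw [e]), h3⟩
  obtain ⟨b, hb, hbi⟩ := TransGen.head'_iff.1 (h1.transGen hC (hfull _ h1.mem))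
  have hb' : b ≠ f i := by rintro rfl; exact C.H.loopless _ hb.2.2
  have hbarc := hb.2.2
  have hbD := arc_of_mem hbarc (hfull _ h1.mem) (hfull _ hb.2.1)
  rw [hupi, hup _ hb'] at hbarc
  obtain rfl := (h.hole i).out_unique hC hy hbD hij hbarc hyj
  obtain ⟨k, hk, hki, -⟩ := key _ hbi
  exact hki (h.inj hk.symm)

/-- A color cycle of length at least three spans the block that contains it. -/
theorem range_eq (hC : C.Bad) [NeZero n] (h : C.ColorCycle t f) (hn : 3 ≤ n)
    (hB : D.IsBlock B) (hsub : Set.range f ⊆ B.verts) : B.verts = Set.range f := by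
  classical
  refine Set.Subset.antisymm ?_ hsub
  by_contra hnot
  rw [Set.not_subset] at hnot
  obtain ⟨w', hw'B, hw'⟩ := hnot
  have h10 : (1 : ZMod n) ≠ 0 := fun e => by
    have := (ZMod.natCast_eq_zero_iff 1 n).1 (by exact_mod_cast e)
    have := Nat.le_of_dvd (by norm_num) this
    omega
  have h20 : (2 : ZMod n) ≠ 0 := fun e => by
    have := (ZMod.natCast_eq_zero_iff 2 n).1 (by exact_mod_cast e)
    have := Nat.le_of_dvd (by norm_num) this
    omega
  -- Nonseparability provides an ear: an outside neighbor `w` of `f k`, and a walk from `w` through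
  -- outside vertices back to some `f j` with `j ≠ k`.
  obtain ⟨k, w, hwB, hw, hkw⟩ : ∃ k w, w ∈ B.verts ∧ w ∉ Set.range f ∧
      (D.Arc (f k) w ∨ D.Arc w (f k)) := by
    obtain ⟨_, ⟨k, rfl⟩, h2, -⟩ :=
      (hB.nonsep.conn w' hw'B (f 0) (hsub ⟨0, rfl⟩)).exists_first
        (P := (· ∈ Set.range f)) ⟨0, rfl⟩
    rcases ReflTransGen.cases_tail h2 with h3 | ⟨w, -, h3, h4⟩
    · exact absurd ⟨k, h3⟩ hw'
    · exact ⟨k, w, h3.1, h4, h3.2.2.symm⟩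
  have hwf : ∀ i, f i ≠ w := fun i e => hw ⟨i, e⟩
  obtain ⟨j, hjk, hwalk⟩ : ∃ j, j ≠ k ∧
      ReflTransGen (D.AdjOn ((Set.range f)ᶜ ∪ {f j})) w (f j) := by
    have hmem : f (k + 1) ∈ B.verts \ {f k} :=
      ⟨hsub ⟨_, rfl⟩, fun e => h10 (by simpa using h.inj e)⟩
    obtain ⟨_, ⟨j, rfl⟩, h2, -⟩ :=
      (hB.nonsep.conn_diff (f k) w ⟨hwB, (hwf k).symm⟩ _ hmem).exists_first
        (P := (· ∈ Set.range f)) ⟨k + 1, rfl⟩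
    have h3 : ∀ b, ReflTransGen (fun x y => D.AdjOn (B.verts \ {f k}) x y ∧ x ∉ Set.range f) w b →
        b ∈ B.verts \ {f k} ∧ ReflTransGen (D.AdjOn ((Set.range f)ᶜ ∪ {b})) w b := by
      intro b hb
      induction hb with
      | refl => exact ⟨⟨hwB, (hwf k).symm⟩, .refl⟩
      | tail _ hs ih =>
        refine ⟨hs.1.2.1, ReflTransGen.tail (FinDigraph.reflTransGen_adjOn_mono ?_ ih.2)
          ⟨.inl hs.2, .inr rfl, hs.1.2.2⟩⟩
        rintro q (hq | rfl)
        · exact .inl hq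
        · exact .inl hs.2
    exact ⟨j, fun e => (h3 _ h2).1.2 (by rw [e]; rfl), (h3 _ h2).2⟩
  obtain ⟨y, hy, hyw⟩ := (h.hole k).exists_color hC hkw
  have hyk : y ≠ t (f k) := by
    rintro rfl
    rcases hyw with ⟨h1, h2⟩ | ⟨h1, h2⟩
    · exact hwf _ (h.eq_next hC h1 h2).symm
    · exact hwf _ (h.eq_prev hC h1 h2).symm
  -- The hole runs along the ear to `f j`, leaving `y` at `f k`. Storing the old color at the hole
  -- makes the cycle differ from `t` only at `f k`.
  obtain ⟨t2, h2, ht2⟩ := ((h.hole k).slide hC hy hyw).slide_walk hC hwalk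
  obtain ⟨t3, h3, ht3, ht3k⟩ : ∃ t3, C.Hole (f j) t3 ∧ (∀ i, i ≠ k → t3 (f i) = t (f i)) ∧
      t3 (f k) = y := by
    refine ⟨Function.update t2 (f j) (t (f j)), h2.update_self _, fun i hi => ?_, ?_⟩
    · by_cases hij : i = j
      · subst hij; simp
      · have hne : f i ≠ f j := fun e => hij (h.inj e)
        rw [Function.update_of_ne hne, ht2 _ (by simp [hne]),
          Function.update_of_ne fun e => hi (h.inj e)]
    · have hne : f k ≠ f j := fun e => hjk (h.inj e).symm
      rw [Function.update_of_ne hne, ht2 _ (by simp [hne]), Function.update_self]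
  clear h2 ht2 hwalk t2
  have hstep : ∀ (t' : α → β) (i : ZMod n), C.Hole (f i) t' → t' (f i) = t (f i) →
      t' (f (i + 1)) = t (f (i + 1)) → C.Hole (f (i + 1)) t' := fun t' i h1 h2 h3 =>
    h1.slide_full hC (h2 ▸ h.mem i) (.inl ⟨h.digraph_arc i, by rw [h2, h3]; exact h.arc i⟩)
  -- Unaltered arcs of the color cycle carry the hole forward to `f (k - 1)`.
  have h3' : C.Hole (f (k - 1)) t3 :=
    (ZMod.forward_induction (k := k) (P := fun i => i ≠ k ∧ C.Hole (f i) t3) ⟨hjk, h3⟩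
      fun i hi hik => ⟨hik, hstep t3 i hi.2 (ht3 i hi.1) (ht3 _ hik)⟩).2
  have hk1 : k - 1 ≠ k := fun e => h10 (by simpa using e)
  have hk2 : k + 1 ≠ k := fun e => h10 (by simpa using e)
  have hk3 : k + 1 ≠ k - 1 := fun e => h20 (by linear_combination e)
  have hk4 : k ≠ k - 1 - 1 := fun e => h20 (by linear_combination e)
  have hk5 : k - 1 - 1 ≠ k - 1 := fun e => h10 (by linear_combination -e)
  have hDk : D.Arc (f (k - 1)) (f k) := by simpa using h.digraph_arc (k - 1)
  have hHk : C.H.Arc (t (f (k - 1))) (t (f k)) := by simpa using h.arc (k - 1)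
  -- Placing `z`, the color matched to `y`, at `f (k - 1)` moves the hole to `f k`, which recovers
  -- its old color.
  obtain ⟨z, hz, hzy⟩ := h3'.exists_color_out hC hDk
  have hzk : z ≠ t (f (k - 1)) := by
    rintro rfl
    rw [ht3k] at hzy
    exact hyk (eq_right_of_arc hzy hHk (h.mem _) hy (h.mem k))
  have h4 := (h3'.slide hC hz (.inl ⟨hDk, hzy⟩)).update_self (t (f k))
  obtain ⟨t5, ht5⟩ : ∃ t5, t5 =
      Function.update (Function.update t3 (f (k - 1)) z) (f k) (t (f k)) := ⟨_, rfl⟩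
  rw [← ht5] at h4
  have ht5i : ∀ i, i ≠ k - 1 → t5 (f i) = t (f i) := by
    intro i hi
    by_cases hik : i = k
    · subst hik; rw [ht5, Function.update_self]
    · rw [ht5, Function.update_of_ne fun e => hik (h.inj e),
        Function.update_of_ne fun e => hi (h.inj e), ht3 i hik]
  have ht5z : t5 (f (k - 1)) = z := by
    rw [ht5, Function.update_of_ne fun e => hk1 (h.inj e), Function.update_self]
  -- Second round, now with `f (k - 1)` as the only altered vertex; one more slide brings the hole
  -- there.
  have h5 : C.Hole (f (k - 1 - 1)) t5 :=
    (ZMod.forward_induction (j := k + 1) (k := k - 1)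
      (P := fun i => i ≠ k - 1 ∧ C.Hole (f i) t5)
      ⟨hk3, hstep t5 k h4 (ht5i k hk1.symm) (ht5i _ hk3)⟩
      fun i hi hik => ⟨hik, hstep t5 i hi.2 (ht5i i hi.1) (ht5i _ hik)⟩).2
  have hDk' : D.Arc (f (k - 1 - 1)) (f (k - 1)) := by simpa using h.digraph_arc (k - 1 - 1)
  obtain ⟨p, hp, hpz⟩ := h5.exists_color_out hC hDk'
  have h6 := h5.slide hC hp (.inl ⟨hDk', hpz⟩)
  -- `z` needs an out-neighbor again. On the cycle only `f k` is possible, but its old color is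
  -- matched to `t (f (k - 1)) ≠ z`. Off the cycle the colors are those of `t3`, where `f k` was the
  -- unique out-neighbor of `z`.
  obtain ⟨b, hb, hzb⟩ := h6.exists_out hC hz
  by_cases hbf : b ∈ Set.range f
  · obtain ⟨m, rfl⟩ := hbf
    have hm := h.chordless hC hb
    rw [sub_add_cancel] at hm
    subst hm
    rw [Function.update_of_ne fun e => hk4 (h.inj e), ht5i _ hk1.symm] at hzb
    exact hzk (eq_left_of_arc hzb hHk hz (h.mem _) (h.mem _))
  · have hbne : ∀ i, b ≠ f i := fun i e => hbf ⟨i, e.symm⟩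
    rw [Function.update_of_ne (hbne _), ht5, Function.update_of_ne (hbne _),
      Function.update_of_ne (hbne _)] at hzb
    exact hbne k (h3'.out_unique hC hz hb hDk hzb hzy)

end ColorCycle

open Classical in
theorem Hole.exists_colorCycle_through (hC : C.Bad) (h : C.Hole v t) (hx : x ∈ C.X v) :
    ∃ (n : ℕ) (_ : NeZero n) (f : ZMod n → α), f 0 = v ∧
      C.ColorCycle (Function.update t v x) f ∧ C.H.Arc x (t (f 1)) ∧ C.H.Arc (t (f (-1))) x := by
  obtain ⟨n, hn, f, h0, hf⟩ := (h.update_self x).exists_colorCycle hC (h.update_full hx)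
  refine ⟨n, hn, f, h0, hf, ?_, ?_⟩
  · have h1 := hf.arc 0
    have h2 := hf.digraph_arc 0
    rw [zero_add, h0] at h1 h2
    rwa [Function.update_self, Function.update_of_ne (FinDigraph.ne_of_arc h2).symm] at h1
  · have h1 := hf.arc (-1)
    have h2 := hf.digraph_arc (-1)
    rw [neg_add_cancel, h0] at h1 h2
    rwa [Function.update_self, Function.update_of_ne (FinDigraph.ne_of_arc h2)] at h1

/-- If `w` follows `v` on the color cycle closed by `x`, the arc from `w` to `v` is not a chord only
when the cycle has length two, and then `w` also precedes `v`. The converse is symmetric. -/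
theorem Hole.arc_symm (hC : C.Bad) (h : C.Hole v t) (hx : x ∈ C.X v) (hvw : D.Arc v w)
    (hwv : D.Arc w v) : C.H.Arc x (t w) ↔ C.H.Arc (t w) x := by
  obtain ⟨n, hn, f, h0, hf, h1, h2⟩ := h.exists_colorCycle_through hC hx
  have hd1 := hf.digraph_arc 0
  have hd2 := hf.digraph_arc (-1)
  rw [zero_add, h0] at hd1
  rw [neg_add_cancel, h0] at hd2
  constructor
  · intro h3
    obtain rfl := h.out_unique hC hx hvw hd1 h3 h1
    have := hf.chordless hC (i := 1) (j := 0) (by rwa [h0])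
    rwa [neg_eq_of_add_eq_zero_left this.symm] at h2
  · intro h3
    obtain rfl := h.in_unique hC hx hwv hd2 h3 h2
    have := hf.chordless hC (i := 0) (j := -1) (by rwa [h0])
    rw [zero_add] at this
    rwa [← this] at h1

/-- The color cycle through `v`, with `v` removed, connects the successor to the predecessor. -/
theorem Hole.conn_out_in (hC : C.Bad) (h : C.Hole v t) (hx : x ∈ C.X v) (hw : D.Arc v w)
    (hu : D.Arc u v) (h1 : C.H.Arc x (t w)) (h2 : C.H.Arc (t u) x) :
    ReflTransGen (D.AdjOn (D.verts \ {v})) w u := by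
  obtain ⟨n, hn, f, h0, hf, h3, h4⟩ := h.exists_colorCycle_through hC hx
  have hd1 := hf.digraph_arc 0
  have hd2 := hf.digraph_arc (-1)
  rw [zero_add, h0] at hd1
  rw [neg_add_cancel, h0] at hd2
  obtain rfl := h.out_unique hC hx hw hd1 h1 h3
  obtain rfl := h.in_unique hC hx hu hd2 h2 h4
  refine FinDigraph.reflTransGen_adjOn_mono ?_ (hf.nonsep.conn_diff v _
    ⟨⟨1, rfl⟩, (FinDigraph.ne_of_arc hd1).symm⟩ _ ⟨⟨-1, rfl⟩, FinDigraph.ne_of_arc hd2⟩)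
  exact Set.sdiff_subset_sdiff_left hf.nonsep.subset

/-- A block is a directed cycle, or it is symmetric. -/
theorem directedCycle_or_symm (hC : C.Bad) (hmin : C.IsMinimalUncolorable) (hB : D.IsBlock B) :
    (∃ n, B.IsDirectedCycle n) ∨ ∀ u v, B.Arc u v → B.Arc v u := by
  by_contra! hno
  obtain ⟨hno, v, w, hvw, hwv⟩ := hno
  obtain ⟨hD, hvB, hwB⟩ := hB.arc_iff.1 hvw
  have hwvD : ¬ D.Arc w v := fun h => hwv (hB.arc_iff.2 ⟨h, hwB, hvB⟩)
  obtain ⟨t, ht⟩ | ⟨-, h⟩ := exists_hole_or_isolated hC hmin (D.left_mem hD)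
  swap
  · exact (h w).1 hD
  obtain ⟨x, hx, hxw⟩ := ht.exists_color_out hC hD
  obtain ⟨n, hn, f, h0, hf, h1, -⟩ := ht.exists_colorCycle_through hC hx
  have hd1 := hf.digraph_arc 0
  rw [zero_add, h0] at hd1
  obtain rfl := ht.out_unique hC hx hD hd1 hxw h1
  -- Length two would supply the missing arc from `w` to `v`.
  have hn3 : 3 ≤ n := by
    have h0 := NeZero.ne n
    by_contra hlt
    obtain rfl | rfl : n = 1 ∨ n = 2 := by omega
    · rw [Subsingleton.elim (1 : ZMod 1) 0, ‹f 0 = v›] at hd1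
      exact D.loopless _ hd1
    · have := hf.digraph_arc 1
      rw [show (1 : ZMod 2) + 1 = 0 from rfl, ‹f 0 = v›] at this
      exact hwvD this
  have hsub := hB.nonsep_subset hf.nonsep ⟨hvB, 0, h0⟩ ⟨hwB, 1, rfl⟩ (FinDigraph.ne_of_arc hD)
  have hr := hf.range_eq hC hn3 hB hsub
  refine hno n ⟨by omega, f, hf.inj, hr, fun p q => ?_⟩
  rw [hB.arc_iff, hr]
  constructor
  · rintro ⟨h2, ⟨i, rfl⟩, ⟨j, rfl⟩⟩
    obtain rfl := hf.chordless hC h2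
    exact ⟨i, rfl, rfl⟩
  · rintro ⟨i, rfl, rfl⟩
    exact ⟨hf.digraph_arc i, ⟨_, rfl⟩, ⟨_, rfl⟩⟩

/-- Moving the uncolored vertex once around a cycle `c₀ c₁ c₂ … z` in which `c₀` has no chord. -/
theorem Hole.arc_of_walk (hC : C.Bad) {c₀ c₁ c₂ z : α} {s : β} {Q : Set α} (h : C.Hole c₀ t)
    (h01 : D.Arc c₀ c₁) (h12 : D.Arc c₁ c₂) (h20 : c₂ ≠ c₀) (hz : D.Arc c₀ z) (hz' : D.Arc z c₀)
    (hz1 : z ≠ c₁) (h0Q : c₀ ∉ Q) (h1Q : c₁ ∉ Q) (hQ : ∀ q ∈ Q, D.Arc c₀ q → q = z)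
    (hwalk : ReflTransGen (D.AdjOn Q) c₂ z) (hx : x ∈ C.X c₀) (hxz : C.H.Arc x (t z))
    (hs : s ∈ C.X c₁) (hs2 : C.H.Arc s (t c₂)) : C.H.Arc x s := by
  classical
  obtain ⟨y, hy, hy1⟩ := h.exists_color_out hC h01
  have h1 := h.slide hC hy (.inl ⟨h01, hy1⟩)
  have h2 := h1.slide hC hs (.inl ⟨h12, by rwa [Function.update_of_ne h20]⟩)
  obtain ⟨t3, h3, ht3⟩ := h2.slide_walk hC hwalk
  have h01' := FinDigraph.ne_of_arc h01
  have ht30 : t3 c₀ = y := by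
    rw [ht3 _ h0Q, Function.update_of_ne h01', Function.update_self]
  have ht31 : t3 c₁ = s := by rw [ht3 _ h1Q, Function.update_self]
  obtain ⟨s', hs', hs'y⟩ := h3.exists_color_out hC hz'
  have h4 := h3.slide hC hs' (.inl ⟨hz', hs'y⟩)
  have hys' := (h3.arc_symm hC hs' hz' hz).1 hs'y
  rw [ht30] at hys'
  -- After the round trip `z` is matched to `y ≠ x`, and all neighbors of `c₀` other than `z` and
  -- `c₁` keep their colors. So the out-neighbor of `x` has to be `c₁`.
  obtain ⟨b, hb, hxb⟩ := h4.exists_out hC hx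
  by_cases hbz : b = z
  · subst hbz
    rw [Function.update_self] at hxb
    obtain rfl := eq_left_of_arc hxb hys' hx hy hs'
    exact absurd (h.out_unique hC hx hz h01 hxz hy1) hz1
  · rw [Function.update_of_ne hbz] at hxb
    by_cases hb1 : b = c₁
    · rwa [hb1, ht31] at hxb
    · rw [ht3 b fun hbQ => hbz (hQ b hbQ hb), Function.update_of_ne hb1,
        Function.update_of_ne (FinDigraph.ne_of_arc hb).symm] at hxb
      exact absurd (h.out_unique hC hx hb hz hxb hxz) hbz

end DigraphCover

/-! ### Symmetric nonseparable digraphs with injective links. -/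

namespace FinDigraph

variable {α : Type*} {B : FinDigraph α} {c₀ c₁ c₂ u v w z z' : α}

/-- `c₂` can be joined to the neighbour `z ≠ c₁` of `c₀` by a walk that avoids `c₁`, `c₀` and all
other neighbours of `c₀`. -/
def Link (B : FinDigraph α) (c₀ c₁ c₂ z : α) : Prop :=
  B.Arc c₀ z ∧ z ≠ c₁ ∧ ∃ Q : Set α, c₀ ∉ Q ∧ c₁ ∉ Q ∧
    (∀ q ∈ Q, B.Arc c₀ q → q = z) ∧ ReflTransGen (B.AdjOn Q) c₂ z

/-- A symmetric digraph without separating vertex in which links are injective in both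
directions. -/
structure LinkInjective (B : FinDigraph α) : Prop where
  symm : ∀ u v, B.Arc u v → B.Arc v u
  nonsep : B.Nonsep B.verts
  right_unique : ∀ c₀ c₁ c₂ z z', B.Arc c₀ c₁ → B.Arc c₁ c₂ → c₂ ≠ c₀ →
    B.Link c₀ c₁ c₂ z → B.Link c₀ c₁ c₂ z' → z = z'
  left_unique : ∀ c₀ c₁ c₂ c₂' z, B.Arc c₀ c₁ → B.Arc c₁ c₂ → B.Arc c₁ c₂' → c₂ ≠ c₀ → c₂' ≠ c₀ →
    B.Link c₀ c₁ c₂ z → B.Link c₀ c₁ c₂' z → c₂ = c₂'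

namespace LinkInjective

/-- As `c₁` does not separate, some walk from `c₂` to `c₀` avoids it; it is cut off at the first
neighbor of `c₀`. -/
theorem exists_link (hB : B.LinkInjective) (h01 : B.Arc c₀ c₁) (h12 : B.Arc c₁ c₂)
    (h20 : c₂ ≠ c₀) : ∃ z, B.Link c₀ c₁ c₂ z := by
  have hw := hB.nonsep.conn_diff c₁ c₂ ⟨B.right_mem h12, (ne_of_arc h12).symm⟩ c₀
    ⟨B.left_mem h01, ne_of_arc h01⟩
  rcases ReflTransGen.cases_tail hw with h | ⟨q, hq, hq0⟩
  · exact absurd h.symm h20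
  have hPq : B.Arc c₀ q := hq0.2.2.elim (hB.symm _ _) id
  obtain ⟨z, hz, h1, -⟩ := hq.exists_first (P := fun q => B.Arc c₀ q) hPq
  have key : ∀ y, ReflTransGen
      (fun x y => B.AdjOn (B.verts \ {c₁}) x y ∧ ¬ B.Arc c₀ x) c₂ y → y ≠ c₀ ∧ y ≠ c₁ ∧
      ReflTransGen (B.AdjOn {q | q ≠ c₀ ∧ q ≠ c₁ ∧ (B.Arc c₀ q → q = y)}) c₂ y := by
    intro y hy
    induction hy with
    | refl => exact ⟨h20, (ne_of_arc h12).symm, .refl⟩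
    | tail _ hs ih =>
      rename_i y y' _
      obtain ⟨i1, i2, i3⟩ := ih
      have hy'0 : y' ≠ c₀ := by
        rintro rfl
        exact hs.2 (hs.1.2.2.elim (hB.symm _ _) id)
      refine ⟨hy'0, hs.1.2.1.2, (reflTransGen_adjOn_mono ?_ i3).tail
        ⟨⟨i1, i2, fun h => absurd h hs.2⟩, ⟨hy'0, hs.1.2.1.2, fun _ => rfl⟩, hs.1.2.2⟩⟩
      exact fun q hq => ⟨hq.1, hq.2.1, fun h => absurd (hq.2.2 h ▸ h) hs.2⟩
  obtain ⟨-, hz1, hk⟩ := key z h1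
  exact ⟨z, hz, hz1, _, fun h => h.1 rfl, fun h => h.2.1 rfl, fun q hq => hq.2.2, hk⟩

theorem finite_out (B : FinDigraph α) (v : α) : {w | B.Arc v w}.Finite :=
  B.finite_verts.subset fun _ hw => B.right_mem hw

/-- Choosing links injects the neighbors of `c₁` other than `c₀` into the neighbors of `c₀` other
than `c₁`. -/
theorem outDegree_le (hB : B.LinkInjective) (h : B.Arc c₀ c₁) :
    B.outDegree c₁ ≤ B.outDegree c₀ := by
  have h' := hB.symm _ _ h
  have h1 : ∀ c : α, ∃ z, B.Arc c₁ c ∧ c ≠ c₀ → B.Link c₀ c₁ c z := fun c => by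
    by_cases hc : B.Arc c₁ c ∧ c ≠ c₀
    · obtain ⟨z, hz⟩ := hB.exists_link h hc.1 hc.2
      exact ⟨z, fun _ => hz⟩
    · exact ⟨c, fun h => absurd h hc⟩
  choose ρ hρ using h1
  have h2 : ({w | B.Arc c₁ w} \ {c₀}).ncard ≤ ({w | B.Arc c₀ w} \ {c₁}).ncard := by
    refine Set.ncard_le_ncard_of_injOn ρ (fun c hc => ?_) (fun c hc c' hc' he => ?_)
      ((finite_out B c₀).sdiff)
    · exact ⟨(hρ c hc).1, (hρ c hc).2.1⟩
    · exact hB.left_unique c₀ c₁ c c' (ρ c) h hc.1 hc'.1 hc.2 hc'.2 (hρ c hc) (he ▸ hρ c' hc')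
  rw [Set.ncard_sdiff_singleton_of_mem (show c₀ ∈ {w | B.Arc c₁ w} from h'),
    Set.ncard_sdiff_singleton_of_mem (show c₁ ∈ {w | B.Arc c₀ w} from h)] at h2
  have h3 : 0 < {w | B.Arc c₀ w}.ncard := (Set.ncard_pos (finite_out B c₀)).2 ⟨c₁, h⟩
  unfold outDegree
  omega

/-- The middle vertex of an induced path on three vertices has no further neighbours. -/
theorem eq_or_eq_of_induced_path (hB : B.LinkInjective) (h01 : B.Arc c₀ c₁) (h12 : B.Arc c₁ c₂)
    (h20 : c₂ ≠ c₀) (h02 : ¬ B.Arc c₀ c₂) {y : α} (hy : B.Arc c₁ y) : y = c₀ ∨ y = c₂ := by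
  by_contra! hne
  obtain ⟨hy0, hy2⟩ := hne
  have h10 := hB.symm _ _ h01
  have h21 := hB.symm _ _ h12
  obtain ⟨z, hz⟩ := hB.exists_link h01 h12 h20
  have hRu := hB.right_unique c₀ c₁ c₂
  -- `A` is the component of `c₂` among the vertices that are neither `c₀` nor neighbors of `c₀`.
  -- Uniqueness of links leaves `A` only the outside neighbors `c₁` and `z`, and leaves `c₁` only
  -- the neighbor `c₂` in `A ∪ {z}`.
  let W : Set α := {q | q ≠ c₀ ∧ ¬ B.Arc c₀ q}
  let A : Set α := {a | ReflTransGen (B.AdjOn W) c₂ a}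
  have hc2W : c₂ ∈ W := ⟨h20, h02⟩
  have hAW : ∀ a ∈ A, a ∈ W := fun a ha => mem_of_reflTransGen_adjOn ha hc2W
  have hA : ∀ a ∈ A, ∀ b, B.Arc a b → b ∈ A ∨ b = c₁ ∨ b = z := by
    intro a ha b hab
    have haW := hAW a ha
    by_cases hbW : b ∈ W
    · exact .inl (ReflTransGen.tail ha ⟨haW, hbW, .inl hab⟩)
    right
    have hb0 : b ≠ c₀ := by
      rintro rfl
      exact haW.2 (hB.symm _ _ hab)
    have hb : B.Arc c₀ b := by
      by_contra hb
      exact hbW ⟨hb0, hb⟩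
    by_cases hb1 : b = c₁
    · exact .inl hb1
    refine .inr (hRu b z h01 h12 h20 ⟨hb, hb1, W ∪ {b}, ?_, ?_, ?_, ?_⟩ hz)
    · rintro (h | h)
      · exact h.1 rfl
      · exact hb0 h.symm
    · rintro (h | h)
      · exact h.2 h01
      · exact hb1 h.symm
    · rintro q (hq | hq) h
      · exact absurd h hq.2
      · exact hq
    · exact (reflTransGen_adjOn_mono Set.subset_union_left ha).tail
        ⟨.inl haW, .inr rfl, .inl hab⟩
  have hA1 : ∀ a ∈ A, B.Arc c₁ a → a = c₂ := by
    intro a ha h1a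
    have haW := hAW a ha
    refine hB.left_unique c₀ c₁ a c₂ z h01 h1a h12 haW.1 h20 ?_ hz
    obtain ⟨hz1, hz2, Q, q1, q2, q3, q4⟩ := hz
    refine ⟨hz1, hz2, W ∪ Q, ?_, ?_, ?_, ?_⟩
    · rintro (h | h)
      · exact h.1 rfl
      · exact q1 h
    · rintro (h | h)
      · exact h.2 h01
      · exact q2 h
    · rintro q (hq | hq) h
      · exact absurd h hq.2
      · exact q3 q hq h
    · exact (reflTransGen_adjOn_mono Set.subset_union_left (reflTransGen_adjOn_symm ha)).trans
        (reflTransGen_adjOn_mono Set.subset_union_right q4)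
  have hz0 : z ≠ c₀ := (ne_of_arc hz.1).symm
  have h1z : ¬ B.Arc c₁ z := by
    intro h1z
    have : z = c₂ := hB.left_unique c₀ c₁ z c₂ z h01 h1z h12 hz0 h20
      ⟨hz.1, hz.2.1, {z}, fun h => hz0 h.symm, fun h => hz.2.1 h.symm, fun q hq _ => hq, .refl⟩ hz
    exact h02 (this ▸ hz.1)
  have hyA : y ∉ A ∪ {z} := by
    rintro (h | rfl)
    · exact hy2 (hA1 y h hy)
    · exact h1z hy
  have h0A : c₀ ∉ A ∪ {z} := by
    rintro (h | h)
    · exact (hAW _ h).1 rfl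
    · exact hz0 h.symm
  -- A walk that avoids `c₁` can enter `A ∪ {z}` only at `z`, and all neighbors of `c₂` except `c₁`
  -- lie in this set.
  have hit : ∀ (p p' : α) (Q : Set α), B.Arc c₂ p' → p' ≠ c₁ → p ∉ A ∪ {z} → c₁ ∉ Q →
      ReflTransGen (B.AdjOn Q) p p' →
      ReflTransGen (fun x y => B.AdjOn Q x y ∧ x ∉ A ∪ {z}) p z ∧
        ReflTransGen (B.AdjOn Q) z p' := by
    intro p p' Q hp' hp1 hp h1Q hw
    have hp'A : p' ∈ A ∪ {z} := by
      rcases hA c₂ .refl p' hp' with h | h | h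
      · exact .inl h
      · exact absurd h hp1
      · exact .inr h
    obtain ⟨h, hh, w1, w2⟩ := hw.exists_first (P := (· ∈ A ∪ {z})) hp'A
    have hhz : h = z := by
      rcases ReflTransGen.cases_tail w1 with e | ⟨x, -, hx, hxA⟩
      · exact absurd (e ▸ hh) hp
      rcases hh with hh | hh
      · rcases hA h hh x (hx.2.2.elim (hB.symm _ _) id) with e | e | e
        · exact absurd (.inl e) hxA
        · exact absurd (e ▸ hx.1) h1Q
        · exact absurd (.inr e) hxA
      · exact hh
    exact ⟨hhz ▸ w1, hhz ▸ w2⟩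
  -- The roles are reversed: seen from `c₂`, the vertices `c₀` and `y` have different links, yet
  -- both linking walks pass through `z`.
  obtain ⟨z0, hz0L⟩ := hB.exists_link h21 h10 h20.symm
  obtain ⟨z1, hz1L⟩ := hB.exists_link h21 hy hy2
  have hne : z0 ≠ z1 := by
    rintro rfl
    exact hy0 (hB.left_unique c₂ c₁ y c₀ z0 h21 hy h10 hy2 h20.symm hz1L hz0L)
  obtain ⟨a1, a2, Q0, a3, a4, a5, a6⟩ := id hz0L
  obtain ⟨b1, b2, Q1, b3, b4, b5, b6⟩ := id hz1L
  obtain ⟨-, hw0⟩ := hit c₀ z0 Q0 a1 a2 h0A a4 a6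
  obtain ⟨hw1, hw1'⟩ := hit y z1 Q1 b1 b2 hyA b4 b6
  by_cases h2z : B.Arc c₂ z
  · have e0 : z = z0 := by
      rcases ReflTransGen.cases_head hw0 with e | ⟨_, e, -⟩
      · exact e
      · exact a5 z e.1 h2z
    have e1 : z = z1 := by
      rcases ReflTransGen.cases_head hw1' with e | ⟨_, e, -⟩
      · exact e
      · exact b5 z e.1 h2z
    exact hne (e0.symm.trans e1)
  -- The walk from `y` to `z` is spliced with the walk from `z` to `z0`, so `y` is linked to `z0`
  -- too.
  · refine hne (hB.right_unique c₂ c₁ y z0 z1 h21 hy hy2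
      ⟨a1, a2, {q | q ∈ Q1 ∧ q ∉ A ∪ {z}} ∪ {z} ∪ Q0, ?_, ?_, ?_, ?_⟩ hz1L)
    · rintro ((h | h) | h)
      · exact b3 h.1
      · exact (show c₂ ≠ z from fun e => h02 (e ▸ hz.1)) h
      · exact a3 h
    · rintro ((h | h) | h)
      · exact b4 h.1
      · exact hz.2.1 (Eq.symm h)
      · exact a4 h
    · rintro q ((hq | rfl) | hq) h2q
      · exfalso
        obtain rfl := b5 q hq.1 h2q
        rcases hA c₂ .refl q h2q with h | h | h
        · exact hq.2 (.inl h)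
        · exact b2 h
        · exact hq.2 (.inr h)
      · exact absurd h2q h2z
      · exact a5 q hq h2q
    · refine ReflTransGen.trans ?_ (reflTransGen_adjOn_mono Set.subset_union_right hw0)
      have key : ∀ p, ReflTransGen (fun x y => B.AdjOn Q1 x y ∧ x ∉ A ∪ {z}) y p →
          ReflTransGen (B.AdjOn ({q | q ∈ Q1 ∧ q ∉ A ∪ {z}} ∪ {p})) y p := by
        intro p hp
        induction hp with
        | refl => exact .refl
        | tail _ hs ih =>
          refine ReflTransGen.tail (reflTransGen_adjOn_mono ?_ ih)
            ⟨.inl ⟨hs.1.1, hs.2⟩, .inr rfl, hs.1.2.2⟩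
          rintro q (hq | rfl)
          · exact .inl hq
          · exact .inl ⟨hs.1.1, hs.2⟩
      exact reflTransGen_adjOn_mono Set.subset_union_left (key z hw1)

/-- If `B` is not complete, connectedness yields an induced path on three vertices, whose middle
vertex has degree two. Degrees are equal along arcs by `outDegree_le` in both directions, so `B` is
connected and 2-regular. Triangles count as complete, whence `4 ≤ n`. -/
theorem isComplete_or_isBidirectedCycle (hB : B.LinkInjective) :
    B.IsComplete ∨ ∃ n, 4 ≤ n ∧ B.IsBidirectedCycle n := by
  by_cases hcomp : B.IsComplete
  · exact .inl hcomp
  right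
  obtain ⟨c₀, c₁, c₂, h01, h12, h20, h02⟩ :
      ∃ c₀ c₁ c₂, B.Arc c₀ c₁ ∧ B.Arc c₁ c₂ ∧ c₂ ≠ c₀ ∧ ¬ B.Arc c₀ c₂ := by
    by_contra! hno
    refine hcomp fun u hu v hv huv => ?_
    have key : ∀ b, ReflTransGen (B.AdjOn B.verts) u b → b = u ∨ B.Arc u b := by
      intro b hb
      induction hb with
      | refl => exact .inl rfl
      | tail _ hs ih =>
        rename_i b c _
        have hbc : B.Arc b c := hs.2.2.elim id (hB.symm _ _)
        rcases ih with rfl | ih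
        · exact .inr hbc
        · by_cases hcu : c = u
          · exact .inl hcu
          · exact .inr (hno u b c ih hbc hcu)
    exact (key v (hB.nonsep.conn u hu v hv)).resolve_left huv.symm
  have h10 := hB.symm _ _ h01
  have hdeg1 : B.outDegree c₁ = 2 := by
    have : {w | B.Arc c₁ w} = {c₀, c₂} := by
      ext y
      constructor
      · exact fun hy => hB.eq_or_eq_of_induced_path h01 h12 h20 h02 hy
      · rintro (rfl | rfl)
        · exact h10
        · exact h12
    rw [outDegree, this, Set.ncard_pair h20.symm]
  have hdeg : ∀ v ∈ B.verts, B.outDegree v = 2 := by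
    intro v hv
    have hw := hB.nonsep.conn c₁ (B.left_mem h12) v hv
    clear hv
    induction hw with
    | refl => exact hdeg1
    | tail _ hs ih =>
      rename_i b c _
      have hbc : B.Arc b c := hs.2.2.elim id (hB.symm _ _)
      exact (le_antisymm (hB.outDegree_le hbc) (hB.outDegree_le (hB.symm _ _ hbc))).trans ih
  obtain ⟨n, hn, f, hf, hf0, hf1, hf2, -, hadj⟩ :=
    exists_cycle_of_adj (D := B) (S := B.verts \ {c₁}) (.inl h10) (.inl h12) (fun h => h.2 rfl)
      ⟨B.left_mem h01, ne_of_arc h01⟩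
      (hB.nonsep.conn_diff c₁ c₀ ⟨B.left_mem h01, ne_of_arc h01⟩ c₂
        ⟨B.right_mem h12, (ne_of_arc h12).symm⟩)
  have harc : ∀ i, B.Arc (f i) (f (i + 1)) := fun i => (hadj i).elim id (hB.symm _ _)
  have harc' : ∀ i, B.Arc (f i) (f (i - 1)) := fun i => by
    simpa using hB.symm _ _ (harc (i - 1))
  have h1 : (1 : ZMod n) ≠ -1 := fun e => h20 (by rw [← hf1, ← hf2, ← e])
  have hN : ∀ i w, B.Arc (f i) w → w = f (i + 1) ∨ w = f (i - 1) := by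
    intro i
    have hne : f (i + 1) ≠ f (i - 1) := fun e => h1 (by linear_combination hf e)
    have : {f (i + 1), f (i - 1)} = {w | B.Arc (f i) w} := by
      refine Set.eq_of_subset_of_ncard_le ?_ ?_ (finite_out B _)
      · rintro w (rfl | rfl)
        · exact harc i
        · exact harc' i
      · rw [Set.ncard_pair hne]
        exact (hdeg _ (B.left_mem (harc i))).le
    intro w hw
    have hw' : w ∈ ({f (i + 1), f (i - 1)} : Set α) := this ▸ hw
    exact hw'
  have hr : B.verts = Set.range f := by
    refine Set.Subset.antisymm (fun w hw => ?_) (by rintro _ ⟨i, rfl⟩; exact B.left_mem (harc i))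
    have hwalk := hB.nonsep.conn (f 0) (B.left_mem (harc 0)) w hw
    clear hw
    induction hwalk with
    | refl => exact ⟨0, rfl⟩
    | tail _ hs ih =>
      obtain ⟨i, rfl⟩ := ih
      rcases hN i _ (hs.2.2.elim id (hB.symm _ _)) with rfl | rfl
      · exact ⟨_, rfl⟩
      · exact ⟨_, rfl⟩
  have hn4 : 4 ≤ n := by
    have h0 := NeZero.ne n
    by_contra hlt
    obtain rfl | rfl | rfl : n = 1 ∨ n = 2 ∨ n = 3 := by omega
    · exact h1 (Subsingleton.elim _ _)
    · exact h1 rfl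
    · have := harc 1
      rw [show (1 : ZMod 3) + 1 = -1 from rfl, hf1, hf2] at this
      exact h02 this
  refine ⟨n, hn4, by omega, f, hf, hr, fun p q => ⟨fun h => ?_, ?_⟩⟩
  · obtain ⟨i, rfl⟩ : p ∈ Set.range f := hr ▸ B.left_mem h
    rcases hN i q h with rfl | rfl
    · exact ⟨i, .inl ⟨rfl, rfl⟩⟩
    · exact ⟨i - 1, .inr ⟨by simp, rfl⟩⟩
  · rintro ⟨i, ⟨rfl, rfl⟩ | ⟨rfl, rfl⟩⟩
    · exact harc i
    · exact hB.symm _ _ (harc i)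

end LinkInjective

end FinDigraph

/-! ### Links in symmetric blocks of a cover. -/

namespace DigraphCover

variable {α β : Type*} {D B : FinDigraph α} {C : DigraphCover D β} {c₀ c₁ c₂ z : α} {t : α → β}
  {x s : β}

theorem Hole.arc_of_link (hC : C.Bad) (hB : D.IsBlock B) (hsymm : ∀ u v, B.Arc u v → B.Arc v u)
    (ht : C.Hole c₀ t) (h01 : B.Arc c₀ c₁) (h12 : B.Arc c₁ c₂) (h20 : c₂ ≠ c₀)
    (hlink : B.Link c₀ c₁ c₂ z) (hx : x ∈ C.X c₀) (hxz : C.H.Arc x (t z)) (hs : s ∈ C.X c₁)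
    (hs2 : C.H.Arc s (t c₂)) : C.H.Arc x s := by
  have hle : ∀ u v, B.Arc u v → D.Arc u v := hB.prop.1.2
  obtain ⟨hz, hz1, Q, hQ0, hQ1, hQ, hwalk⟩ := hlink
  -- Intersecting with `B.verts` discards neighbors of `c₀` in other blocks, which a link in `B`
  -- does not control.
  have hsub : B.AdjOn Q ≤ D.AdjOn (Q ∩ B.verts) := fun p q h =>
    ⟨⟨h.1, h.2.2.elim B.left_mem B.right_mem⟩, ⟨h.2.1, h.2.2.elim B.right_mem B.left_mem⟩,
      h.2.2.imp (hle _ _) (hle _ _)⟩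
  exact ht.arc_of_walk hC (hle _ _ h01) (hle _ _ h12) h20 (hle _ _ hz)
    (hle _ _ (hsymm _ _ hz)) hz1 (fun h => hQ0 h.1) (fun h => hQ1 h.1)
    (fun q hq h => hQ q hq.1 (hB.arc_iff.2 ⟨h, B.left_mem hz, hq.2⟩))
    (ReflTransGen.mono hsub _ _ hwalk) hx hxz hs hs2

theorem Hole.exists_next (hC : C.Bad) (ht : C.Hole c₀ t) (h01 : D.Arc c₀ c₁) :
    ∃ t', C.Hole c₁ t' ∧ ∀ c, c ≠ c₀ → t' c = t c := by
  classical
  obtain ⟨x, hx, h1⟩ := ht.exists_color_out hC h01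
  exact ⟨_, ht.slide hC hx (.inl ⟨h01, h1⟩), fun c hc => Function.update_of_ne hc _ _⟩

theorem exists_hole_of_digraph_arc (hC : C.Bad) (hmin : C.IsMinimalUncolorable)
    (h : D.Arc c₀ c₁) : ∃ t, C.Hole c₀ t := by
  rcases exists_hole_or_isolated hC hmin (D.left_mem h) with h1 | ⟨-, h1⟩
  · exact h1
  · exact absurd h (h1 c₁).1

/-- For a hole, neighbors correspond to colors: `c₂` to a color `s` of `c₁`, and `z` to a color `x`
of `c₀`. A link forces an arc from `x` to `s`, and such arcs form a matching. -/
theorem linkInjective (hC : C.Bad) (hmin : C.IsMinimalUncolorable) (hB : D.IsBlock B)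
    (hsymm : ∀ u v, B.Arc u v → B.Arc v u) : B.LinkInjective := by
  have hle : ∀ u v, B.Arc u v → D.Arc u v := hB.prop.1.2
  refine ⟨hsymm, ⟨hB.nonsep.nonempty, subset_rfl, ?_, fun v => ?_⟩, ?_, ?_⟩
  · rw [FinDigraph.connOn_congr (D := D)]
    · exact hB.nonsep.conn
    · exact fun a ha b hb => ⟨hle a b, fun h => hB.arc_iff.2 ⟨h, ha, hb⟩⟩
  · rw [FinDigraph.connOn_congr (D := D)]
    · exact hB.nonsep.conn_diff v
    · exact fun a ha b hb => ⟨hle a b, fun h => hB.arc_iff.2 ⟨h, ha.1, hb.1⟩⟩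
  · intro c₀ c₁ c₂ z z' h01 h12 h20 hz hz'
    obtain ⟨t, ht⟩ := exists_hole_of_digraph_arc hC hmin (hle _ _ h01)
    obtain ⟨t', ht', h1⟩ := ht.exists_next hC (hle _ _ h01)
    obtain ⟨s, hs, hs2⟩ := ht'.exists_color_out hC (hle _ _ h12)
    rw [h1 c₂ h20] at hs2
    obtain ⟨x, hx, hxz⟩ := ht.exists_color_out hC (hle _ _ hz.1)
    obtain ⟨x', hx', hxz'⟩ := ht.exists_color_out hC (hle _ _ hz'.1)
    obtain rfl := eq_left_of_arc (ht.arc_of_link hC hB hsymm h01 h12 h20 hz hx hxz hs hs2)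
      (ht.arc_of_link hC hB hsymm h01 h12 h20 hz' hx' hxz' hs hs2) hx hx' hs
    exact ht.out_unique hC hx (hle _ _ hz.1) (hle _ _ hz'.1) hxz hxz'
  · intro c₀ c₁ c₂ c₂' z h01 h12 h12' h20 h20' hz hz'
    obtain ⟨t, ht⟩ := exists_hole_of_digraph_arc hC hmin (hle _ _ h01)
    obtain ⟨t', ht', h1⟩ := ht.exists_next hC (hle _ _ h01)
    obtain ⟨s, hs, hs2⟩ := ht'.exists_color_out hC (hle _ _ h12)
    obtain ⟨s', hs', hs2'⟩ := ht'.exists_color_out hC (hle _ _ h12')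
    obtain ⟨x, hx, hxz⟩ := ht.exists_color_out hC (hle _ _ hz.1)
    have e1 := ht.arc_of_link hC hB hsymm h01 h12 h20 hz hx hxz hs (by rwa [← h1 c₂ h20])
    have e2 := ht.arc_of_link hC hB hsymm h01 h12' h20' hz' hx hxz hs' (by rwa [← h1 c₂' h20'])
    obtain rfl := eq_right_of_arc e1 e2 hx hs hs'
    exact ht'.out_unique hC hs (hle _ _ h12) (hle _ _ h12') hs2 hs2'

end DigraphCover

/-! ### Distribution of the colors among the blocks. -/

namespace DigraphCover

variable {α β : Type*} {D B B' : FinDigraph α} {C : DigraphCover D β} {u v w w' : α} {x y : β}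
  {t t' : α → β}

/-- The out-neighbours of `x` in two acyclic transversals of `D - v` lie in the same component of
`D - v`. -/
theorem Hole.conn_out_out (hC : C.Bad) (h : C.Hole v t) (h' : C.Hole v t') (hx : x ∈ C.X v)
    (hw : D.Arc v w) (hw' : D.Arc v w') (hxw : C.H.Arc x (t w)) (hxw' : C.H.Arc x (t' w')) :
    ReflTransGen (D.AdjOn (D.verts \ {v})) w w' := by
  classical
  by_contra hno
  let P : α → Prop := fun u => ReflTransGen (D.AdjOn (D.verts \ {v})) w u
  -- `s` glues `t` on the component of `w` in `D - v` to `t'` elsewhere. No arc joins different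
  -- components, so `s` is again a hole, in which `x` would have two out-neighbors.
  let s : α → β := fun u => if P u then t u else t' u
  have hs1 : ∀ u, P u → s u = t u := fun u hu => if_pos hu
  have hs2 : ∀ u, ¬ P u → s u = t' u := fun u hu => if_neg hu
  have hcol : ∀ u ∈ D.verts, u ≠ v → s u ∈ C.X u := fun u hu huv => by
    by_cases hP : P u
    · rw [hs1 u hP]; exact h.color u hu huv
    · rw [hs2 u hP]; exact h'.color u hu huv
  have hstep : ∀ p q, C.Rel (D.verts \ {v}) s p q → (P p ↔ P q) := fun p q hpq => by
    have hadj : D.AdjOn (D.verts \ {v}) p q := ⟨hpq.1, hpq.2.1,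
      .inl (arc_of_mem hpq.2.2 (hcol p hpq.1.1 hpq.1.2) (hcol q hpq.2.1.1 hpq.2.1.2))⟩
    exact ⟨fun hp => ReflTransGen.tail hp hadj, fun hq => ReflTransGen.tail hq hadj.symm⟩
  have hole : C.Hole v s := by
    refine ⟨h.mem, hcol, fun a ha => ?_⟩
    by_cases hPa : P a
    · have key : ∀ b, TransGen (C.Rel (D.verts \ {v}) s) a b →
          P b ∧ TransGen (C.Rel (D.verts \ {v}) t) a b := by
        have one : ∀ p q, P p → C.Rel (D.verts \ {v}) s p q →
            P q ∧ C.Rel (D.verts \ {v}) t p q := fun p q hp hpq => by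
          have hq := (hstep p q hpq).1 hp
          exact ⟨hq, hpq.1, hpq.2.1, by rw [← hs1 p hp, ← hs1 q hq]; exact hpq.2.2⟩
        intro b hb
        induction hb with
        | single hb => exact ⟨(one _ _ hPa hb).1, .single (one _ _ hPa hb).2⟩
        | tail _ hb ih => exact ⟨(one _ _ ih.1 hb).1, ih.2.tail (one _ _ ih.1 hb).2⟩
      exact h.acyclic a (key a ha).2
    · have key : ∀ b, TransGen (C.Rel (D.verts \ {v}) s) a b →
          ¬ P b ∧ TransGen (C.Rel (D.verts \ {v}) t') a b := by
        have one : ∀ p q, ¬ P p → C.Rel (D.verts \ {v}) s p q →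
            ¬ P q ∧ C.Rel (D.verts \ {v}) t' p q := fun p q hp hpq => by
          have hq := fun hq => hp ((hstep p q hpq).2 hq)
          exact ⟨hq, hpq.1, hpq.2.1, by rw [← hs2 p hp, ← hs2 q hq]; exact hpq.2.2⟩
        intro b hb
        induction hb with
        | single hb => exact ⟨(one _ _ hPa hb).1, .single (one _ _ hPa hb).2⟩
        | tail _ hb ih => exact ⟨(one _ _ ih.1 hb).1, ih.2.tail (one _ _ ih.1 hb).2⟩
      exact h'.acyclic a (key a ha).2
  have := hole.out_unique hC hx hw hw' (by rwa [hs1 w .refl]) (by rwa [hs2 w' hno])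
  exact hno (this ▸ .refl)

/-- The colors of `v` that belong to the block `B`. -/
def blockX (C : DigraphCover D β) (B : FinDigraph α) (v : α) : Set β :=
  {x | x ∈ C.X v ∧ ∃ t w, C.Hole v t ∧ B.Arc v w ∧ C.H.Arc x (t w)}

theorem mem_verts_of_mem_blockX (hx : x ∈ C.blockX B v) : v ∈ B.verts := by
  obtain ⟨-, t, w, -, h, -⟩ := hx
  exact B.left_mem h

/-- `blockX` asks for one hole only; by `conn_out_out` all holes at `v` agree on the block. -/
theorem Hole.mem_of_mem_blockX (hC : C.Bad) (hB : D.IsBlock B) (h : C.Hole v t)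
    (hx : x ∈ C.blockX B v) (hw : D.Arc v w) (hxw : C.H.Arc x (t w)) : w ∈ B.verts := by
  obtain ⟨hxX, t', w', h', hw', hxw'⟩ := hx
  have hD' := hB.prop.1.2 _ _ hw'
  obtain ⟨B', hB', hv, h1, h2⟩ := FinDigraph.exists_block_of_walk (.inl hD') (.inl hw)
    (h'.conn_out_out hC h hxX hD' hw hxw' hxw)
  rwa [hB.eq_of_two_mem hB' (B.left_mem hw') hv (B.right_mem hw') h1 (FinDigraph.ne_of_arc hD')]

theorem Hole.mem_blockX_of_in (hC : C.Bad) (hB : D.IsBlock B) (h : C.Hole v t) (hx : x ∈ C.X v)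
    (hu : D.Arc u v) (huB : u ∈ B.verts) (hvB : v ∈ B.verts) (hux : C.H.Arc (t u) x) :
    x ∈ C.blockX B v := by
  obtain ⟨w, hw, hxw⟩ := h.exists_out hC hx
  obtain ⟨B', hB', hv, h1, h2⟩ := FinDigraph.exists_block_of_walk (.inl hw) (.inr hu)
    (h.conn_out_in hC hx hw hu hxw hux)
  obtain rfl := hB.eq_of_two_mem hB' hvB hv huB h2 (FinDigraph.ne_of_arc hu).symm
  exact ⟨hx, t, w, h, hB.arc_iff.2 ⟨hw, hvB, h1⟩, hxw⟩

theorem eq_of_mem_blockX (hC : C.Bad) (hB : D.IsBlock B) (hB' : D.IsBlock B')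
    (hx : x ∈ C.blockX B v) (hx' : x ∈ C.blockX B' v) : B = B' := by
  obtain ⟨hxX, t, w, ht, hw, hxw⟩ := id hx
  have hD := hB.prop.1.2 _ _ hw
  exact hB.eq_of_two_mem hB' (B.left_mem hw) (mem_verts_of_mem_blockX hx') (B.right_mem hw)
    (ht.mem_of_mem_blockX hC hB' hx' hD hxw) (FinDigraph.ne_of_arc hD)

theorem exists_mem_blockX (hC : C.Bad) (hmin : C.IsMinimalUncolorable) (hx : x ∈ C.X v) :
    ∃ B, D.IsBlock B ∧ x ∈ C.blockX B v := by
  rcases exists_hole_or_isolated hC hmin (mem_verts_of_mem hx) with ⟨t, ht⟩ | ⟨h, -⟩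
  · obtain ⟨w, hw, hxw⟩ := ht.exists_out hC hx
    obtain ⟨B, hB, h1, h2, -⟩ := FinDigraph.exists_block_of_walk (.inl hw) (.inl hw) .refl
    exact ⟨B, hB, hx, t, w, ht, hB.arc_iff.2 ⟨hw, h1, h2⟩, hxw⟩
  · rw [h] at hx
    exact absurd hx (Set.notMem_empty x)

theorem mem_blockX_of_arc (hC : C.Bad) (hmin : C.IsMinimalUncolorable) (hB : D.IsBlock B)
    (hxy : C.H.Arc x y) (hx : x ∈ C.X u) (hy : y ∈ C.X v) (hu : u ∈ B.verts) (hv : v ∈ B.verts) :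
    x ∈ C.blockX B u ∧ y ∈ C.blockX B v := by
  obtain ⟨u', v', t, rfl, rfl, hD, ht, h1, h2⟩ := exists_hole_of_arc hC hmin hxy
  obtain rfl := eq_of_mem hx (ht _ h1.mem)
  obtain rfl := eq_of_mem hy (ht _ h2.mem)
  exact ⟨⟨hx, t, v, h1, hB.arc_iff.2 ⟨hD, hu, hv⟩, hxy⟩,
    h2.mem_blockX_of_in hC hB hy hD hu hv hxy⟩

/-- The bijection between colors and out-neighbors given by a single hole restricts to `B`. -/
theorem ncard_blockX (hC : C.Bad) (hmin : C.IsMinimalUncolorable) (hB : D.IsBlock B)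
    (hv : v ∈ B.verts) : (C.blockX B v).ncard = B.outDegree v := by
  have hle : ∀ u v, B.Arc u v → D.Arc u v := hB.prop.1.2
  rcases exists_hole_or_isolated hC hmin (hB.prop.1.1 hv) with ⟨t, ht⟩ | ⟨h, h'⟩
  · choose f hf1 hf2 using fun w (hw : B.Arc v w) => ht.exists_color_out hC (hle _ _ hw)
    refine (Set.ncard_congr (s := {w | B.Arc v w}) f ?_ ?_ ?_).symm
    · exact fun w hw => ⟨hf1 w hw, t, w, ht, hw, hf2 w hw⟩
    · intro w w' hw hw' he
      have h2 := hf2 w' hw'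
      rw [← he] at h2
      exact ht.out_unique hC (hf1 w hw) (hle _ _ hw) (hle _ _ hw') (hf2 w hw) h2
    · intro x hx
      obtain ⟨w, hw, hxw⟩ := ht.exists_out hC hx.1
      have hwB := ht.mem_of_mem_blockX hC hB hx hw hxw
      have hw' : B.Arc v w := hB.arc_iff.2 ⟨hw, hv, hwB⟩
      exact ⟨w, hw', eq_left_of_arc (hf2 w hw') hxw (hf1 w hw') hx.1 (ht.color_of_arc (.inl hw))⟩
  · have h1 : C.blockX B v = ∅ := Set.eq_empty_of_forall_notMem fun x hx => by
      have := hx.1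
      rw [h] at this
      exact this
    have h2 : {w | B.Arc v w} = ∅ :=
      Set.eq_empty_of_forall_notMem fun w hw => (h' w).1 (hle _ _ hw)
    rw [h1, FinDigraph.outDegree, h2, Set.ncard_empty, Set.ncard_empty]

/-- The cover of the block `B` induced by the colors that belong to `B`. -/
def blockCover (C : DigraphCover D β) (B : FinDigraph α) (hB : D.IsBlock B) :
    DigraphCover B β where
  X := C.blockX B
  H := C.H.induce {x | ∃ v, x ∈ C.blockX B v}
  X_eq_empty v hv := Set.eq_empty_of_forall_notMem fun _ hx => hv (mem_verts_of_mem_blockX hx)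
  disjoint u _ v _ huv := Set.disjoint_left.2 fun _ hx hy => huv (eq_of_mem hx.1 hy.1)
  verts_eq := by
    ext x
    simp only [Set.mem_iUnion]
    constructor
    · rintro ⟨-, v, hv⟩
      exact ⟨v, mem_verts_of_mem_blockX hv, hv⟩
    · rintro ⟨v, -, hv⟩
      exact ⟨mem_H_verts hv.1, v, hv⟩
  independent v hv x hx y hy h :=
    C.independent v (hB.prop.1.1 hv) x hx.1 y hy.1 h.1
  matching u v huv a ha b hb hab :=
    C.matching u v (hB.prop.1.2 _ _ huv) a ⟨ha.1.1, ha.2.1.1, ha.2.2.1⟩ b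
      ⟨hb.1.1, hb.2.1.1, hb.2.2.1⟩ hab
  arc := by
    rintro x y ⟨h, ⟨u, hu⟩, ⟨v, hv⟩⟩
    exact ⟨u, v, hB.arc_iff.2 ⟨arc_of_mem h hu.1 hv.1, mem_verts_of_mem_blockX hu,
      mem_verts_of_mem_blockX hv⟩, hu, hv⟩

theorem blockCover_arc_iff (hC : C.Bad) (hmin : C.IsMinimalUncolorable) (hB : D.IsBlock B)
    (hx : x ∈ C.X u) (hy : y ∈ C.X v) (hu : u ∈ B.verts) (hv : v ∈ B.verts) :
    (C.blockCover B hB).H.Arc x y ↔ C.H.Arc x y := by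
  refine ⟨fun h => h.1, fun h => ?_⟩
  have h1 := mem_blockX_of_arc hC hmin hB h hx hy hu hv
  exact ⟨h, ⟨u, h1.1⟩, ⟨v, h1.2⟩⟩

/-- All colors used on the block of the uncolored vertex belong to that block. -/
theorem Hole.color_mem_blockX (hC : C.Bad) (hmin : C.IsMinimalUncolorable) (hB : D.IsBlock B)
    (h : C.Hole v t) (hv : v ∈ B.verts) (hw : w ∈ B.verts) (hwv : w ≠ v) :
    t w ∈ C.blockX B w := by
  -- Stopping on first arrival at `w` brings the hole next to `w` without recoloring `w`; then `t w`
  -- has an arc from or to a color of that neighbor.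
  obtain ⟨_, rfl, h1, -⟩ := (hB.nonsep.conn v hv w hw).exists_first (P := (· = w)) rfl
  rename_i w
  have key : ∀ b, ReflTransGen (fun x y => D.AdjOn B.verts x y ∧ x ≠ w) v b → b ∈ B.verts ∧
      (b ≠ w → ReflTransGen (D.AdjOn (B.verts \ {w})) v b) := by
    intro b hb
    induction hb with
    | refl => exact ⟨hv, fun _ => .refl⟩
    | tail _ hs ih =>
      exact ⟨hs.1.2.1, fun hne => (ih.2 hs.2).tail ⟨⟨hs.1.1, hs.2⟩, ⟨hs.1.2.1, hne⟩, hs.1.2.2⟩⟩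
  rcases ReflTransGen.cases_tail h1 with e | ⟨p, hp, hpw, hne⟩
  · exact absurd e hwv
  obtain ⟨t', h2, ht'⟩ := h.slide_walk hC ((key p hp).2 hne)
  rw [← ht' w fun h => h.2 rfl]
  rcases hpw.2.2 with hD | hD
  · obtain ⟨x, hx, hxw⟩ := h2.exists_color_out hC hD
    exact (mem_blockX_of_arc hC hmin hB hxw hx (h2.color_of_arc (.inl hD)) hpw.1 hw).2
  · obtain ⟨x, hx, hxw⟩ := h2.exists_color_in hC hD
    exact (mem_blockX_of_arc hC hmin hB hxw (h2.color_of_arc (.inr hD)) hx hw hpw.1).1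

/-- In a symmetric block the arcs of `H` come in opposite pairs. -/
theorem blockCover_arc_symm (hC : C.Bad) (hmin : C.IsMinimalUncolorable) (hB : D.IsBlock B)
    (hsymm : ∀ u v, B.Arc u v → B.Arc v u) (h : (C.blockCover B hB).H.Arc x y) :
    (C.blockCover B hB).H.Arc y x := by
  obtain ⟨u, v, huv, hx, hy⟩ := (C.blockCover B hB).arc x y h
  obtain ⟨u', v', t, rfl, rfl, hD, ht, h1, h2⟩ := exists_hole_of_arc hC hmin h.1
  obtain rfl := eq_of_mem hx.1 (ht _ h1.mem)
  obtain rfl := eq_of_mem hy.1 (ht _ h2.mem)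
  rw [blockCover_arc_iff hC hmin hB hy.1 hx.1 (B.right_mem huv) (B.left_mem huv)]
  exact (h1.arc_symm hC hx.1 hD (hB.prop.1.2 _ _ (hsymm _ _ huv))).1 h.1

theorem exists_blockCover_arc (hC : C.Bad) (hmin : C.IsMinimalUncolorable) (hB : D.IsBlock B)
    (huv : B.Arc u v) :
    ∃ x ∈ C.blockX B u, ∃ y ∈ C.blockX B v, (C.blockCover B hB).H.Arc x y := by
  have hD := hB.prop.1.2 _ _ huv
  obtain ⟨t, ht⟩ := exists_hole_of_digraph_arc hC hmin hD
  obtain ⟨x, hx, hxv⟩ := ht.exists_color_out hC hD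
  have h1 := mem_blockX_of_arc hC hmin hB hxv hx (ht.color_of_arc (.inl hD)) (B.left_mem huv)
    (B.right_mem huv)
  exact ⟨x, h1.1, _, h1.2, hxv, ⟨_, h1.1⟩, ⟨_, h1.2⟩⟩

/-! ### C-configurations and K-configurations on blocks. -/

theorem isCConfiguration_blockCover (hC : C.Bad) (hmin : C.IsMinimalUncolorable)
    (hB : D.IsBlock B) {n : ℕ} (hcyc : B.IsDirectedCycle n) :
    (C.blockCover B hB).IsCConfiguration := by
  refine ⟨⟨n, hcyc⟩, ?_⟩
  obtain ⟨-, f, hf, hr, harc⟩ := hcyc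
  have hX : ∀ v ∈ B.verts, ∃ z, C.blockX B v = {z} := by
    intro v hv
    rw [← Set.ncard_eq_one, ncard_blockX hC hmin hB hv, FinDigraph.outDegree, Set.ncard_eq_one]
    rw [hr] at hv
    obtain ⟨i, rfl⟩ := hv
    refine ⟨f (i + 1), Set.ext fun w => ?_⟩
    rw [Set.mem_ofPred_eq, harc, Set.mem_singleton_iff]
    constructor
    · rintro ⟨j, h1, rfl⟩
      rw [hf h1]
    · rintro rfl
      exact ⟨i, rfl, rfl⟩
  obtain ⟨v₀, hv₀⟩ := hB.nonsep.nonempty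
  obtain ⟨z₀, -⟩ := hX v₀ hv₀
  have hX' : ∀ v, ∃ z, v ∈ B.verts → C.blockX B v = {z} := fun v => by
    by_cases hv : v ∈ B.verts
    · obtain ⟨z, hz⟩ := hX v hv
      exact ⟨z, fun _ => hz⟩
    · exact ⟨z₀, fun h => absurd h hv⟩
  choose ξ hξ using hX'
  refine ⟨ξ, hξ, fun a b => ⟨fun h => ?_, ?_⟩⟩
  · obtain ⟨u, v, huv, ha, hb⟩ := (C.blockCover B hB).arc a b h
    have ha' : a ∈ C.blockX B u := ha
    have hb' : b ∈ C.blockX B v := hb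
    rw [hξ u (B.left_mem huv)] at ha'
    rw [hξ v (B.right_mem huv)] at hb'
    exact ⟨u, v, huv, ha', hb'⟩
  · rintro ⟨u, v, huv, rfl, rfl⟩
    obtain ⟨x, hx, y, hy, hxy⟩ := exists_blockCover_arc hC hmin hB huv
    rw [hξ u (B.left_mem huv)] at hx
    rw [hξ v (B.right_mem huv)] at hy
    rwa [← show x = ξ u from hx, ← show y = ξ v from hy]

/-- A cover of a complete digraph in which adjacency of colors is symmetric and extends to
triangles is a K-configuration. -/
theorem isKConfiguration_of_triangles {C : DigraphCover B β} (hne : B.verts.Nonempty)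
    (hcomp : B.IsComplete) (hcard : ∀ v ∈ B.verts, (C.X v).ncard = B.outDegree v)
    (hsymm : ∀ x y, C.H.Arc x y → C.H.Arc y x)
    (hout : ∀ v, ∀ x ∈ C.X v, ∃ y, C.H.Arc x y)
    (htri : ∀ u v w x y, x ∈ C.X u → y ∈ C.X v → w ∈ B.verts → w ≠ u → w ≠ v → C.H.Arc x y →
      ∃ s ∈ C.X w, C.H.Arc x s ∧ C.H.Arc s y) :
    C.IsKConfiguration := by
  classical
  have hdeg : ∀ v ∈ B.verts, (C.X v).ncard = B.verts.ncard - 1 := by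
    intro v hv
    have : {w | B.Arc v w} = B.verts \ {v} := by
      ext w
      exact ⟨fun h => ⟨B.right_mem h, (FinDigraph.ne_of_arc h).symm⟩,
        fun h => hcomp v hv w h.1 (Ne.symm h.2)⟩
    rw [hcard v hv, FinDigraph.outDegree, this, Set.ncard_sdiff_singleton_of_mem hv]
  have hext : ∀ u, ∀ x ∈ C.X u, ∀ w ∈ B.verts, w ≠ u → ∃ s ∈ C.X w, C.H.Arc x s := by
    intro u x hx w hw hwu
    obtain ⟨y, hxy⟩ := hout u x hx
    obtain ⟨-, v, -, -, hy⟩ := C.arc x y hxy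
    by_cases hwv : w = v
    · subst hwv; exact ⟨y, hy, hxy⟩
    · obtain ⟨s, hs, h1, -⟩ := htri u v w x y hx hy hw hwu hwv hxy
      exact ⟨s, hs, h1⟩
  obtain ⟨v₀, hv₀⟩ := hne
  obtain ⟨n, hn⟩ : ∃ n, n = B.verts.ncard := ⟨_, rfl⟩
  have hn1 : 1 ≤ n := by
    rw [hn]
    exact (Set.ncard_pos B.finite_verts).2 ⟨v₀, hv₀⟩
  rw [← hn] at hdeg
  have : Finite (C.X v₀) := C.finite_X v₀
  let e : Fin (n - 1) ≃ C.X v₀ := (Finite.equivFinOfCardEq (by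
    rw [Nat.card_coe_set_eq, hdeg v₀ hv₀])).symm
  -- The colors of `v₀` are labeled arbitrarily, and label `i` elsewhere is the color matched to `e
  -- i`. Triangles through `v₀` show that equal labels are adjacent.
  have hlab : ∀ v i, ∃ y, v ∈ B.verts → y ∈ C.X v ∧
      (v = v₀ ∧ y = e i ∨ v ≠ v₀ ∧ C.H.Arc (e i) y) := by
    intro v i
    by_cases hv : v ∈ B.verts
    · by_cases hvv : v = v₀
      · subst hvv
        exact ⟨e i, fun _ => ⟨(e i).2, .inl ⟨rfl, rfl⟩⟩⟩
      · obtain ⟨s, hs, h1⟩ := hext v₀ (e i) (e i).2 v hv hvv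
        exact ⟨s, fun _ => ⟨hs, .inr ⟨hvv, h1⟩⟩⟩
    · exact ⟨e i, fun h => absurd h hv⟩
  choose l hl using hlab
  have harc : ∀ u ∈ B.verts, ∀ v ∈ B.verts, u ≠ v → ∀ i, C.H.Arc (l u i) (l v i) := by
    intro u hu v hv huv i
    obtain ⟨hu1, ⟨rfl, hu2⟩ | ⟨hu3, hu2⟩⟩ := hl u i hu
    · obtain ⟨hv1, ⟨rfl, hv2⟩ | ⟨hv3, hv2⟩⟩ := hl v i hv
      · exact absurd rfl huv
      · rwa [hu2]
    · obtain ⟨hv1, ⟨rfl, hv2⟩ | ⟨hv3, hv2⟩⟩ := hl v i hv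
      · rw [hv2]; exact hsymm _ _ hu2
      · obtain ⟨s, hs, h1, h2⟩ := htri v₀ u v _ _ (e i).2 hu1 hv hv3 huv.symm hu2
        rw [eq_right_of_arc hv2 h1 (e i).2 hv1 hs]
        exact hsymm _ _ h2
  have hrange : ∀ v ∈ B.verts, Function.Injective (l v) ∧ Set.range (l v) = C.X v := by
    intro v hv
    have hinj : Function.Injective (l v) := by
      intro i j hij
      obtain ⟨hi1, ⟨hi0, hi2⟩ | ⟨hi3, hi2⟩⟩ := hl v i hv
      · obtain ⟨hj1, ⟨-, hj2⟩ | ⟨hj3, -⟩⟩ := hl v j hv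
        · exact e.injective (Subtype.ext (by rw [← hi2, ← hj2, hij]))
        · exact absurd hi0 hj3
      · obtain ⟨hj1, ⟨hj3, -⟩ | ⟨-, hj2⟩⟩ := hl v j hv
        · exact absurd hj3 hi3
        · rw [← hij] at hj2
          exact e.injective (Subtype.ext (eq_left_of_arc hi2 hj2 (e i).2 (e j).2 hi1))
    refine ⟨hinj, Set.eq_of_subset_of_ncard_le ?_ ?_ (C.finite_X v)⟩
    · rintro _ ⟨i, rfl⟩
      exact (hl v i hv).1
    · rw [hdeg v hv, ← Set.image_univ, Set.ncard_image_of_injective _ hinj, Set.ncard_univ,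
        Nat.card_eq_fintype_card, Fintype.card_fin]
  refine ⟨n, hn1, hcomp, hn.symm, hdeg, l, hrange, ?_, ?_, ?_⟩
  · rintro i _ ⟨-, u, hu, rfl⟩ _ ⟨-, v, hv, rfl⟩ hne
    exact ⟨harc u hu v hv (fun e => hne (by rw [e])) i, ⟨u, hu, rfl⟩, ⟨v, hv, rfl⟩⟩
  · ext x
    rw [Set.mem_iUnion]
    constructor
    · intro hx
      have hx' := hx
      rw [C.verts_eq] at hx'
      simp only [Set.mem_iUnion] at hx'
      obtain ⟨v, hv, hxv⟩ := hx'
      rw [← (hrange v hv).2] at hxv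
      obtain ⟨i, rfl⟩ := hxv
      exact ⟨i, hx, v, hv, rfl⟩
    · rintro ⟨i, hx, -⟩
      exact hx
  · intro x y
    constructor
    · intro hxy
      obtain ⟨u, v, huv, hx, hy⟩ := C.arc x y hxy
      have hx' := hx
      rw [← (hrange u (B.left_mem huv)).2] at hx'
      obtain ⟨i, rfl⟩ := hx'
      have h1 := harc u (B.left_mem huv) v (B.right_mem huv) (FinDigraph.ne_of_arc huv) i
      have h2 := eq_right_of_arc hxy h1 hx hy (hl v i (B.right_mem huv)).1
      exact ⟨i, hxy, ⟨u, B.left_mem huv, rfl⟩, ⟨v, B.right_mem huv, h2⟩⟩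
    · rintro ⟨i, h, -⟩
      exact h

theorem isKConfiguration_blockCover (hC : C.Bad) (hmin : C.IsMinimalUncolorable)
    (hB : D.IsBlock B) (hsymm : ∀ u v, B.Arc u v → B.Arc v u) (hcomp : B.IsComplete) :
    (C.blockCover B hB).IsKConfiguration := by
  have hle : ∀ u v, B.Arc u v → D.Arc u v := hB.prop.1.2
  refine isKConfiguration_of_triangles hB.nonsep.nonempty hcomp
    (fun v hv => ncard_blockX hC hmin hB hv)
    (fun x y h => blockCover_arc_symm hC hmin hB hsymm h) (fun v x hx => ?_) ?_
  · obtain ⟨hxX, t, w, ht, hw, hxw⟩ := hx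
    exact ⟨t w, (blockCover_arc_iff hC hmin hB hxX (ht.color_of_arc (.inl (hle _ _ hw)))
      (B.left_mem hw) (B.right_mem hw)).2 hxw⟩
  · intro u v w x y hx hy hw hwu hwv hxy
    obtain ⟨u', v', t, rfl, rfl, hD, ht, h1, h2⟩ := exists_hole_of_arc hC hmin hxy.1
    obtain rfl := eq_of_mem hx.1 (ht _ h1.mem)
    obtain rfl := eq_of_mem hy.1 (ht _ h2.mem)
    have hu := mem_verts_of_mem_blockX hx
    have hv := mem_verts_of_mem_blockX hy
    have huw := hcomp u hu w hw hwu.symm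
    have hwv' := hcomp w hw v hv hwv
    have hvu : v ≠ u := (FinDigraph.ne_of_arc hD).symm
    obtain ⟨t', ht', h3⟩ := h1.exists_next hC (hle _ _ huw)
    obtain ⟨s, hs, hsv⟩ := ht'.exists_color_out hC (hle _ _ hwv')
    rw [h3 v hvu] at hsv
    -- On a triangle the link is degenerate: `c₂` and `z` are both `v`, joined by the trivial walk.
    have hxs := h1.arc_of_link hC hB hsymm huw hwv' hvu
      ⟨hcomp u hu v hv hvu.symm, hwv.symm, {v}, hvu.symm, hwv, fun q hq _ => hq, .refl⟩
      hx.1 hxy.1 hs hsv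
    have hxs' := (blockCover_arc_iff hC hmin hB hx.1 hs hu hw).2 hxs
    exact ⟨s, (mem_blockX_of_arc hC hmin hB hxs hx.1 hs hu hw).2, hxs',
      (blockCover_arc_iff hC hmin hB hs hy.1 hw hv).2 hsv⟩

end DigraphCover

/-! ### BC-configurations on blocks. -/

theorem Fin.eq_add_one_of_ne {a b : Fin 2} (h : a ≠ b) : a = b + 1 := by
  revert a b; decide

theorem Fin.add_one_ne {a : Fin 2} : a + 1 ≠ a := by
  revert a; decide

namespace DigraphCover

variable {α β : Type*} {D B B' : FinDigraph α} {u v w w' : α} {x y : β} {n : ℕ}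

/-- The data on a cover of a bidirected cycle that force a BC-configuration. -/
structure BCData (C : DigraphCover B β) (f : ZMod n → α) (t : α → β) : Prop where
  inj : Function.Injective f
  verts : B.verts = Set.range f
  arc_iff : ∀ u v, B.Arc u v ↔ ∃ i, (u = f i ∧ v = f (i + 1)) ∨ (u = f (i + 1) ∧ v = f i)
  card : ∀ v ∈ B.verts, (C.X v).ncard = 2
  symm : ∀ x y, C.H.Arc x y → C.H.Arc y x
  next : ∀ i, ∀ x ∈ C.X (f i), ∃ y ∈ C.X (f (i + 1)), C.H.Arc x y
  mem : ∀ i, i ≠ 0 → t (f i) ∈ C.X (f i)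
  indep : ∀ i, i ≠ 0 → i + 1 ≠ 0 → ¬ C.H.Arc (t (f i)) (t (f (i + 1)))
  ends : ∃ x ∈ C.X (f 0), ∃ y ∈ C.X (f 0), x ≠ y ∧ C.H.Arc x (t (f 1)) ∧ C.H.Arc y (t (f (-1)))

open scoped Fin.CommRing in
/-- A labeling of a cover of a bidirected cycle along the cycle. -/
theorem BCData.exists_labeling {C : DigraphCover B β} [NeZero n] {f : ZMod n → α} {t : α → β}
    (h : BCData C f t) (hn : 4 ≤ n) : ∃ l : α → Fin 2 → β, C.IsLabeling l ∧
      (∀ i, i ≠ -1 → ∀ j, C.H.Arc (l (f i) j) (l (f (i + 1)) j)) ∧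
      ∀ j, C.H.Arc (l (f (-1)) j) (l (f 0) (j + (n + 1 : ℕ))) := by
  have hmemB : ∀ i, f i ∈ B.verts := fun i => h.verts ▸ ⟨i, rfl⟩
  have hnext : ∀ (i : ZMod n) (x : β), ∃ y, x ∈ C.X (f i) → y ∈ C.X (f (i + 1)) ∧ C.H.Arc x y := by
    intro i x
    by_cases hx : x ∈ C.X (f i)
    · obtain ⟨y, hy, hxy⟩ := h.next i x hx
      exact ⟨y, fun _ => ⟨hy, hxy⟩⟩
    · exact ⟨x, fun h => absurd h hx⟩
  choose M hM using hnext
  have : Finite (C.X (f 0)) := C.finite_X _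
  let e : Fin 2 ≃ C.X (f 0) := (Finite.equivFinOfCardEq (by
    rw [Nat.card_coe_set_eq, h.card _ (hmemB 0)])).symm
  -- Labels are carried along the matchings from `f 0`; after `n` steps `g n` labels the colors of
  -- `f 0` a second time.
  let g : ℕ → Fin 2 → β := fun k => Nat.rec (fun j => (e j : β)) (fun k r j => M k (r j)) k
  have hg0 : ∀ j, g 0 j = e j := fun _ => rfl
  have hgs : ∀ k j, g (k + 1) j = M k (g k j) := fun _ _ => rfl
  clear_value g
  have hmem : ∀ (k : ℕ) j, g k j ∈ C.X (f (k : ZMod n)) := by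
    intro k
    induction k with
    | zero => intro j; rw [hg0, Nat.cast_zero]; exact (e j).2
    | succ k ih => intro j; rw [hgs, Nat.cast_succ]; exact (hM _ _ (ih j)).1
  have harc : ∀ (k : ℕ) j, C.H.Arc (g k j) (g (k + 1) j) := fun k j => by
    rw [hgs]; exact (hM _ _ (hmem k j)).2
  have hinj : ∀ k, Function.Injective (g k) := by
    intro k
    induction k with
    | zero => exact fun i j hij => e.injective (Subtype.ext (by rwa [hg0, hg0] at hij))
    | succ k ih =>
      intro i j hij
      have h1 := harc k j
      rw [← hij] at h1
      exact ih (eq_left_of_arc (harc k i) h1 (hmem k i) (hmem k j) (hmem (k + 1) i))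
  have hrange : ∀ k : ℕ, Set.range (g k) = C.X (f (k : ZMod n)) := by
    intro k
    refine Set.eq_of_subset_of_ncard_le ?_ ?_ (C.finite_X _)
    · rintro _ ⟨j, rfl⟩; exact hmem k j
    · rw [h.card _ (hmemB _), ← Set.image_univ, Set.ncard_image_of_injective _ (hinj k),
        Set.ncard_univ, Nat.card_eq_fintype_card, Fintype.card_fin]
  have hcast : ∀ k : ℕ, 0 < k → k < n → (k : ZMod n) ≠ 0 := fun k h0 hk e => by
    have := Nat.le_of_dvd h0 ((ZMod.natCast_eq_zero_iff k n).1 e)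
    omega
  have hlast : ((n - 1 : ℕ) : ZMod n) = -1 := by
    rw [Nat.cast_sub (by omega)]; simp
  obtain ⟨p, hp, q, hq, hpq, hpt, hqt⟩ := h.ends
  obtain ⟨a, ha⟩ : p ∈ Set.range (g 0) := by rw [hrange, Nat.cast_zero]; exact hp
  obtain ⟨b, hb⟩ : q ∈ Set.range (g 0) := by rw [hrange, Nat.cast_zero]; exact hq
  have hba : b = a + 1 := Fin.eq_add_one_of_ne fun e => hpq (by rw [← ha, ← hb, e])
  -- Consecutive colors of `t` are not adjacent, so the label changes at every step.
  have halt : ∀ k : ℕ, k + 1 < n → t (f ((k + 1 : ℕ) : ZMod n)) = g (k + 1) (a + (k : ℕ)) := by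
    intro k
    induction k with
    | zero =>
      intro h1
      have h2 := harc 0 a
      rw [ha] at h2
      have h3 := h.mem ((0 + 1 : ℕ) : ZMod n) (hcast _ (by omega) h1)
      have h4 : C.H.Arc p (t (f ((0 + 1 : ℕ) : ZMod n))) := by simpa using hpt
      simpa using eq_right_of_arc h4 h2 hp h3 (hmem 1 a)
    | succ k ih =>
      intro h1
      have h2 := ih (by omega)
      have h3 := h.mem ((k + 1 + 1 : ℕ) : ZMod n) (hcast _ (by omega) h1)
      rw [← hrange] at h3
      obtain ⟨j, hj⟩ := h3
      rw [← hj]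
      refine congrArg _ ?_
      rw [Nat.cast_succ, ← add_assoc]
      apply Fin.eq_add_one_of_ne
      rintro rfl
      have h5 := h.indep ((k + 1 : ℕ) : ZMod n) (hcast _ (by omega) (by omega)) (by
        have := hcast (k + 1 + 1) (by omega) h1
        rwa [Nat.cast_succ] at this)
      rw [← Nat.cast_succ, Nat.succ_eq_add_one, h2, ← hj] at h5
      exact h5 (harc _ _)
  have hgn : ∀ j, g n j ∈ Set.range (g 0) := fun j => by
    rw [hrange, Nat.cast_zero, ← ZMod.natCast_self n]; exact hmem n j
  -- `t` begins next to `p`, with label `a`, and ends next to `q`, with label `a + 1`. So label `a +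
  -- (n - 2)` closes up to `a + 1`, a shift by `n + 1` modulo 2, and one value determines a
  -- permutation of two labels.
  have hclose : ∀ j, g n j = g 0 (j + (n + 1 : ℕ)) := by
    have h1 := halt (n - 2) (by omega)
    have e1 : n - 2 + 1 = n - 1 := by omega
    rw [e1, hlast] at h1
    have h2 := harc (n - 1) (a + (n - 2 : ℕ))
    have e2 : n - 1 + 1 = n := by omega
    rw [← h1, e2] at h2
    have h3 : g n (a + (n - 2 : ℕ)) = g 0 (a + 1) := by
      rw [← hba, hb]
      refine eq_right_of_arc h2 (h.symm _ _ hqt) (u := f (-1)) (v := f 0) ?_ ?_ hq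
      · refine h.mem (-1) ?_
        rw [← hlast]
        exact hcast _ (by omega) (by omega)
      · have := hmem n (a + (n - 2 : ℕ))
        rwa [ZMod.natCast_self] at this
    have e3 : ((n + 1 : ℕ) : Fin 2) = ((n - 2 : ℕ) : Fin 2) + 1 := by
      have : n + 1 = n - 2 + 1 + 2 := by omega
      rw [this]; push_cast; simp
    have e4 : ∀ c : Fin 2, c + c = 0 := by decide
    have h4 : g n (a + (n - 2 : ℕ)) = g 0 (a + (n - 2 : ℕ) + (n + 1 : ℕ)) := by
      rw [h3, e3]
      congr 1
      rw [← add_assoc, add_assoc a, e4, add_zero]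
    intro j
    by_cases hj : j = a + (n - 2 : ℕ)
    · rw [hj, h4]
    · obtain ⟨i, hi⟩ := hgn j
      rw [← hi]
      congr 1
      have hne : i ≠ a + (n - 2 : ℕ) + (n + 1 : ℕ) := by
        rintro rfl
        exact hj (hinj n (by rw [← hi, h4]))
      rw [Fin.eq_add_one_of_ne hne, Fin.eq_add_one_of_ne hj, add_right_comm]
  have hlab : ∀ i, Function.invFun f (f i) = i := Function.leftInverse_invFun h.inj
  refine ⟨fun v => g (Function.invFun f v).val, ?_, ?_, ?_⟩
  · intro v hv
    rw [h.verts] at hv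
    obtain ⟨i, rfl⟩ := hv
    simp only [hlab]
    refine ⟨hinj _, ?_⟩
    rw [hrange, ZMod.natCast_zmod_val]
  · intro i hi j
    simp only [hlab]
    have h1 : i.val + 1 < n := by
      have h2 := ZMod.val_lt i
      by_contra h3
      have h4 : i.val = n - 1 := by omega
      rw [← hlast, ← h4, ZMod.natCast_zmod_val] at hi
      exact hi rfl
    rw [ZMod.val_add_one_eq_mod, Nat.mod_eq_of_lt h1]
    exact harc _ _
  · intro j
    simp only [hlab]
    have h1 : (-1 : ZMod n).val = n - 1 := by
      rw [← hlast, ZMod.val_natCast_of_lt (by omega)]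
    rw [h1, ZMod.val_zero, ← hclose]
    have := harc (n - 1) j
    rwa [show n - 1 + 1 = n by omega] at this

-- The closing shift `n + 1` is trivial for odd `n`; for even `n` it swaps the labels on the edge
-- between `f (-1)` and `f 0`, the exceptional edge.
open scoped Fin.CommRing in
theorem BCData.isBCConfiguration {C : DigraphCover B β} [NeZero n] {f : ZMod n → α} {t : α → β}
    (h : BCData C f t) (hn : 4 ≤ n) : C.IsBCConfiguration := by
  obtain ⟨l, hl, hl1, hl2⟩ := h.exists_labeling hn
  have hmemB : ∀ i, f i ∈ B.verts := fun i => h.verts ▸ ⟨i, rfl⟩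
  have hlmem : ∀ i j, l (f i) j ∈ C.X (f i) := fun i j => by
    rw [← (hl _ (hmemB i)).2]; exact ⟨j, rfl⟩
  have hcyc : B.IsBidirectedCycle n := ⟨by omega, f, h.inj, h.verts, h.arc_iff⟩
  let τ : ZMod n → Fin 2 → Fin 2 := fun i j => if i = -1 then j + (n + 1 : ℕ) else j
  have hτ : ∀ i j, C.H.Arc (l (f i) j) (l (f (i + 1)) (τ i j)) := by
    intro i j
    by_cases hi : i = -1
    · simp only [τ, hi, if_true, neg_add_cancel]; exact hl2 j
    · simp only [τ, hi, if_false]; exact hl1 i hi j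
  have hforward : ∀ i x y, C.H.Arc x y → x ∈ C.X (f i) → y ∈ C.X (f (i + 1)) →
      ∃ j, x = l (f i) j ∧ y = l (f (i + 1)) (τ i j) := by
    intro i x y hxy hx hy
    have hx' := hx
    rw [← (hl _ (hmemB i)).2] at hx'
    obtain ⟨j, rfl⟩ := hx'
    exact ⟨j, rfl, eq_right_of_arc hxy (hτ i j) hx hy (hlmem _ _)⟩
  have hH : ∀ x y, C.H.Arc x y ↔ ∃ i j, (x = l (f i) j ∧ y = l (f (i + 1)) (τ i j)) ∨
      (x = l (f (i + 1)) (τ i j) ∧ y = l (f i) j) := by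
    intro x y
    constructor
    · intro hxy
      obtain ⟨u, v, huv, hx, hy⟩ := C.arc x y hxy
      obtain ⟨i, ⟨rfl, rfl⟩ | ⟨rfl, rfl⟩⟩ := (h.arc_iff u v).1 huv
      · obtain ⟨j, h1, h2⟩ := hforward i x y hxy hx hy
        exact ⟨i, j, .inl ⟨h1, h2⟩⟩
      · obtain ⟨j, h1, h2⟩ := hforward i y x (h.symm _ _ hxy) hy hx
        exact ⟨i, j, .inr ⟨h2, h1⟩⟩
    · rintro ⟨i, j, ⟨rfl, rfl⟩ | ⟨rfl, rfl⟩⟩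
      · exact hτ i j
      · exact h.symm _ _ (hτ i j)
  rcases Nat.even_or_odd n with hpar | hpar
  · right
    have hne : ∀ i, i ≠ -1 → ({f i, f (i + 1)} : Set α) ≠ {f (-1), f 0} := by
      intro i hi e
      have h1 : f i ∈ ({f (-1), f 0} : Set α) := e ▸ .inl rfl
      have h2 : f (-1) ∈ ({f i, f (i + 1)} : Set α) := e ▸ .inl rfl
      rcases h1 with h1 | h1
      · exact hi (h.inj h1)
      · have hi0 : i = 0 := h.inj h1
        subst hi0
        rcases h2 with h2 | h2
        · exact hi (h.inj h2).symm
        · have h3 : (-1 : ZMod n) = 0 + 1 := h.inj h2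
          have h4 : ((2 : ℕ) : ZMod n) = 0 := by push_cast; linear_combination -h3
          have := Nat.le_of_dvd (by omega) ((ZMod.natCast_eq_zero_iff 2 n).1 h4)
          omega
    have hτ0 : ∀ j, τ (-1) j = j + 1 := by
      intro j
      simp only [τ, if_true]
      obtain ⟨k, rfl⟩ := hpar
      congr 1
      have e4 : ∀ c : Fin 2, c + c = 0 := by decide
      push_cast
      rw [e4, zero_add]
    have hτ1 : ∀ i j, i ≠ -1 → τ i j = j := fun i j hi => by simp only [τ, hi, if_false]
    refine ⟨⟨n, hpar, hn, hcyc⟩, f (-1), f 0, ?_, h.card, l, hl, fun x y => ?_⟩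
    · exact (h.arc_iff _ _).2 ⟨-1, .inl ⟨rfl, by rw [neg_add_cancel]⟩⟩
    rw [hH]
    constructor
    · rintro ⟨i, j, hij⟩
      by_cases hi : i = -1
      · subst hi
        rw [hτ0, neg_add_cancel] at hij
        right
        rcases hij with ⟨rfl, rfl⟩ | ⟨rfl, rfl⟩
        · exact ⟨j, j + 1, Fin.add_one_ne.symm, .inl ⟨rfl, rfl⟩⟩
        · exact ⟨j + 1, j, Fin.add_one_ne, .inr ⟨rfl, rfl⟩⟩
      · rw [hτ1 i j hi] at hij
        left
        rcases hij with ⟨rfl, rfl⟩ | ⟨rfl, rfl⟩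
        · exact ⟨_, _, j, hne i hi, (h.arc_iff _ _).2 ⟨i, .inl ⟨rfl, rfl⟩⟩, rfl, rfl⟩
        · exact ⟨_, _, j, by rw [Set.pair_comm]; exact hne i hi,
            (h.arc_iff _ _).2 ⟨i, .inr ⟨rfl, rfl⟩⟩, rfl, rfl⟩
    · rintro (⟨v, w, j, hvw, harc, rfl, rfl⟩ | ⟨i, j, hij, hxy⟩)
      · obtain ⟨i, ⟨rfl, rfl⟩ | ⟨rfl, rfl⟩⟩ := (h.arc_iff v w).1 harc
        · have hi : i ≠ -1 := by rintro rfl; exact hvw (by rw [neg_add_cancel])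
          exact ⟨i, j, .inl ⟨rfl, by rw [hτ1 i j hi]⟩⟩
        · have hi : i ≠ -1 := by rintro rfl; exact hvw (by rw [neg_add_cancel, Set.pair_comm])
          exact ⟨i, j, .inr ⟨by rw [hτ1 i j hi], rfl⟩⟩
      · rcases hxy with ⟨rfl, rfl⟩ | ⟨rfl, rfl⟩
        · refine ⟨-1, i, .inl ⟨rfl, ?_⟩⟩
          rw [neg_add_cancel, hτ0, ← Fin.eq_add_one_of_ne hij.symm]
        · refine ⟨-1, j, .inr ⟨?_, rfl⟩⟩
          rw [neg_add_cancel, hτ0, ← Fin.eq_add_one_of_ne hij]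
  · left
    have hτ' : ∀ i j, τ i j = j := by
      intro i j
      by_cases hi : i = -1
      · simp only [τ, hi, if_true]
        obtain ⟨k, rfl⟩ := hpar
        have e4 : ∀ c : Fin 2, c + c = 0 := by decide
        have : 2 * k + 1 + 1 = (k + 1) + (k + 1) := by ring
        rw [this, Nat.cast_add, e4, add_zero]
      · simp only [τ, hi, if_false]
    simp only [hτ'] at hH
    refine ⟨⟨n, hpar, by rcases hpar with ⟨k, rfl⟩; omega, hcyc⟩, h.card, l, hl, fun x y => ?_⟩
    rw [hH]
    constructor
    · rintro ⟨i, j, ⟨rfl, rfl⟩ | ⟨rfl, rfl⟩⟩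
      · exact ⟨_, _, j, (h.arc_iff _ _).2 ⟨i, .inl ⟨rfl, rfl⟩⟩, rfl, rfl⟩
      · exact ⟨_, _, j, (h.arc_iff _ _).2 ⟨i, .inr ⟨rfl, rfl⟩⟩, rfl, rfl⟩
    · rintro ⟨v, w, j, harc, rfl, rfl⟩
      obtain ⟨i, ⟨rfl, rfl⟩ | ⟨rfl, rfl⟩⟩ := (h.arc_iff v w).1 harc
      · exact ⟨i, j, .inl ⟨rfl, rfl⟩⟩
      · exact ⟨i, j, .inr ⟨rfl, rfl⟩⟩

theorem isBCConfiguration_blockCover {C : DigraphCover D β} (hC : C.Bad)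
    (hmin : C.IsMinimalUncolorable) (hB : D.IsBlock B) (hsymm : ∀ u v, B.Arc u v → B.Arc v u)
    (hn : 4 ≤ n) (hcyc : B.IsBidirectedCycle n) : (C.blockCover B hB).IsBCConfiguration := by
  have hle : ∀ u v, B.Arc u v → D.Arc u v := hB.prop.1.2
  obtain ⟨-, f, hf, hr, harc⟩ := hcyc
  have : NeZero n := ⟨by omega⟩
  have hcast : ∀ k : ℕ, 0 < k → k < n → (k : ZMod n) ≠ 0 := fun k h0 hk e => by
    have := Nat.le_of_dvd h0 ((ZMod.natCast_eq_zero_iff k n).1 e)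
    omega
  have h20 : (2 : ZMod n) ≠ 0 := by simpa using hcast 2 (by omega) (by omega)
  have h10 : (1 : ZMod n) ≠ 0 := by simpa using hcast 1 (by omega) (by omega)
  have hfmem : ∀ i, f i ∈ B.verts := fun i => hr ▸ ⟨i, rfl⟩
  have harc1 : ∀ i, B.Arc (f i) (f (i + 1)) := fun i => (harc _ _).2 ⟨i, .inl ⟨rfl, rfl⟩⟩
  have harc2 : ∀ i, B.Arc (f i) (f (i - 1)) := fun i =>
    (harc _ _).2 ⟨i - 1, .inr ⟨by rw [sub_add_cancel], rfl⟩⟩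
  have hN : ∀ i w, B.Arc (f i) w → w = f (i + 1) ∨ w = f (i - 1) := by
    intro i w hw
    obtain ⟨j, ⟨h1, rfl⟩ | ⟨h1, rfl⟩⟩ := (harc _ _).1 hw
    · rw [hf h1]; exact .inl rfl
    · rw [hf h1, add_sub_cancel_right]; exact .inr rfl
  have hne : ∀ i, f (i + 1) ≠ f (i - 1) := fun i e => h20 (by linear_combination hf e)
  obtain ⟨t, ht⟩ := exists_hole_of_digraph_arc hC hmin (hle _ _ (harc1 0))
  have hmem : ∀ i, i ≠ 0 → t (f i) ∈ C.blockX B (f i) := fun i hi =>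
    ht.color_mem_blockX hC hmin hB (hfmem 0) (hfmem i) fun e => hi (hf e)
  refine BCData.isBCConfiguration (f := f) (t := t) ⟨hf, hr, harc, fun v hv => ?_,
    fun x y h => blockCover_arc_symm hC hmin hB hsymm h, ?_, hmem, ?_, ?_⟩ hn
  · change (C.blockX B v).ncard = 2
    rw [ncard_blockX hC hmin hB hv, FinDigraph.outDegree]
    rw [hr] at hv
    obtain ⟨i, rfl⟩ := hv
    have : {w | B.Arc (f i) w} = {f (i + 1), f (i - 1)} := by
      ext w
      constructor
      · exact hN i w
      · rintro (rfl | rfl)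
        · exact harc1 i
        · exact harc2 i
    rw [this, Set.ncard_pair (hne i)]
  · intro i x hx
    suffices h : ∃ y ∈ C.X (f (i + 1)), C.H.Arc x y by
      obtain ⟨y, hy, hxy⟩ := h
      exact ⟨y, (mem_blockX_of_arc hC hmin hB hxy hx.1 hy (hfmem _) (hfmem _)).2,
        (blockCover_arc_iff hC hmin hB hx.1 hy (hfmem _) (hfmem _)).2 hxy⟩
    obtain ⟨s, hs⟩ := exists_hole_of_digraph_arc hC hmin (hle _ _ (harc1 i))
    obtain ⟨w, hw, hxw⟩ := hs.exists_out hC hx.1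
    have hwB := hs.mem_of_mem_blockX hC hB hx hw hxw
    rcases hN i w (hB.arc_iff.2 ⟨hw, hfmem i, hwB⟩) with rfl | rfl
    · exact ⟨_, hs.color_of_arc (.inl hw), hxw⟩
    -- Here the hole joins `x` to the backward neighbor; the link around the rest of the cycle
    -- transfers this to an arc into `X (f (i + 1))`.
    · have hne2 : f (i + 1 + 1) ≠ f i := fun e => h20 (by linear_combination hf e)
      obtain ⟨z, hz⟩ := (linkInjective hC hmin hB hsymm).exists_link (harc1 i) (harc1 (i + 1)) hne2
      have hzi : z = f (i - 1) := (hN i z hz.1).resolve_left hz.2.1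
      subst hzi
      obtain ⟨s', hs', hss'⟩ := hs.exists_next hC (hle _ _ (harc1 i))
      obtain ⟨y, hy, hyt⟩ := hs'.exists_color_out hC (hle _ _ (harc1 (i + 1)))
      rw [hss' _ hne2] at hyt
      exact ⟨y, hy, hs.arc_of_link hC hB hsymm (harc1 i) (harc1 (i + 1)) hne2 hz hx.1 hxw hy hyt⟩
  -- Arcs come in opposite pairs, so an arc here would be a directed 2-cycle avoiding the hole.
  · intro i hi hi1 h
    have h' := blockCover_arc_symm hC hmin hB hsymm h
    have m1 : f i ∈ D.verts \ {f 0} := ⟨hB.prop.1.1 (hfmem _), fun e => hi (hf e)⟩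
    have m2 : f (i + 1) ∈ D.verts \ {f 0} := ⟨hB.prop.1.1 (hfmem _), fun e => hi1 (hf e)⟩
    exact ht.acyclic (f i) (.tail (.single ⟨m1, m2, h.1⟩) ⟨m2, m1, h'.1⟩)
  · have e1 := harc1 0
    have e2 := harc2 0
    rw [zero_add] at e1
    rw [zero_sub] at e2
    obtain ⟨x, hx, hxt⟩ := ht.exists_color_out hC (hle _ _ e1)
    obtain ⟨y, hy, hyt⟩ := ht.exists_color_out hC (hle _ _ e2)
    have m1 := (hmem 1 h10).1
    have m2 := (hmem (-1) (neg_ne_zero.2 h10)).1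
    refine ⟨x, (mem_blockX_of_arc hC hmin hB hxt hx m1 (hfmem _) (hfmem _)).1, y,
      (mem_blockX_of_arc hC hmin hB hyt hy m2 (hfmem _) (hfmem _)).1, ?_,
      (blockCover_arc_iff hC hmin hB hx m1 (hfmem _) (hfmem _)).2 hxt,
      (blockCover_arc_iff hC hmin hB hy m2 (hfmem _) (hfmem _)).2 hyt⟩
    rintro rfl
    have h := hne 0
    rw [zero_add, zero_sub] at h
    exact h (ht.out_unique hC hx (hle _ _ e1) (hle _ _ e2) hxt hyt)

theorem blockCover_classification {C : DigraphCover D β} (hC : C.Bad)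
    (hmin : C.IsMinimalUncolorable) (hB : D.IsBlock B) :
    (C.blockCover B hB).IsKConfiguration ∨ (C.blockCover B hB).IsCConfiguration ∨
      (C.blockCover B hB).IsBCConfiguration := by
  rcases directedCycle_or_symm hC hmin hB with ⟨n, hn⟩ | hsymm
  · exact .inr (.inl (isCConfiguration_blockCover hC hmin hB hn))
  · rcases (linkInjective hC hmin hB hsymm).isComplete_or_isBidirectedCycle with h | ⟨n, hn, h⟩
    · exact .inl (isKConfiguration_blockCover hC hmin hB hsymm h)
    · exact .inr (.inr (isBCConfiguration_blockCover hC hmin hB hsymm hn h))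

/-- Each color of a K-, C- or BC-configuration is the initial vertex of an arc. -/
theorem exists_arc_of_configuration {C : DigraphCover B β}
    (hconf : C.IsKConfiguration ∨ C.IsCConfiguration ∨ C.IsBCConfiguration) (hx : x ∈ C.X v) :
    ∃ y, C.H.Arc x y := by
  have hv := mem_verts_of_mem hx
  have hbi : ∀ {n : ℕ}, B.IsBidirectedCycle n → ∃ w, B.Arc v w := by
    rintro n ⟨-, f, -, hr, harc⟩
    rw [hr] at hv
    obtain ⟨i, rfl⟩ := hv
    exact ⟨_, (harc _ _).2 ⟨i, .inl ⟨rfl, rfl⟩⟩⟩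
  rcases hconf with h | h | h | h
  · obtain ⟨n, -, -, hn, -, l, hl, hcomp, -⟩ := h
    rw [← (hl v hv).2] at hx
    obtain ⟨i, rfl⟩ := hx
    -- A label `i : Fin (n - 1)` exists only for `n ≥ 2`; with one vertex there are no colors.
    have hn2 : 1 < B.verts.ncard := by
      have := i.2
      omega
    obtain ⟨w, hw, hwv⟩ := Set.exists_ne_of_one_lt_ncard hn2 v
    have m1 : l v i ∈ C.X v := by rw [← (hl v hv).2]; exact ⟨i, rfl⟩
    have m2 : l w i ∈ C.X w := by rw [← (hl w hw).2]; exact ⟨i, rfl⟩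
    exact ⟨l w i, (hcomp i _ ⟨mem_H_verts m1, v, hv, rfl⟩ _ ⟨mem_H_verts m2, w, hw, rfl⟩
      fun e => hwv (eq_of_mem m2 (e ▸ m1))).1⟩
  · obtain ⟨⟨n, -, f, -, hr, harc⟩, ξ, hξ, hH⟩ := h
    rw [hξ v hv] at hx
    obtain rfl : x = ξ v := hx
    rw [hr] at hv
    obtain ⟨i, rfl⟩ := hv
    exact ⟨_, (hH _ _).2 ⟨_, _, (harc _ _).2 ⟨i, rfl, rfl⟩, rfl, rfl⟩⟩
  · obtain ⟨⟨n, -, -, hcyc⟩, -, l, hl, hH⟩ := h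
    rw [← (hl v hv).2] at hx
    obtain ⟨i, rfl⟩ := hx
    obtain ⟨w, hw⟩ := hbi hcyc
    exact ⟨_, (hH _ _).2 ⟨_, _, i, hw, rfl, rfl⟩⟩
  · obtain ⟨⟨n, -, -, hcyc⟩, u, u', -, -, l, hl, hH⟩ := h
    rw [← (hl v hv).2] at hx
    obtain ⟨i, rfl⟩ := hx
    obtain ⟨w, hw⟩ := hbi hcyc
    by_cases he : ({v, w} : Set α) = {u, u'}
    · have hvu : v ∈ ({u, u'} : Set α) := he ▸ .inl rfl
      rcases hvu with rfl | rfl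
      · exact ⟨_, (hH _ _).2 (.inr ⟨i, i + 1, Fin.add_one_ne.symm, .inl ⟨rfl, rfl⟩⟩)⟩
      · exact ⟨_, (hH _ _).2 (.inr ⟨i, i + 1, Fin.add_one_ne.symm, .inr ⟨rfl, rfl⟩⟩)⟩
    · exact ⟨_, (hH _ _).2 (.inl ⟨_, _, i, he, hw, rfl, rfl⟩)⟩

end DigraphCover

/-! ### Existence and uniqueness of the family. -/

open DigraphCover in
theorem mainTheorem4 {α β : Type*} (D : FinDigraph α) (C : DigraphCover D β)
    (hdeg : C.IsDegreeFeasible) (hmin : C.IsMinimalUncolorable) :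
    ∃! F : (B : {B : FinDigraph α // D.IsBlock B}) → DigraphCover B.1 β,
      (∀ B, (F B).IsKConfiguration ∨ (F B).IsCConfiguration ∨ (F B).IsBCConfiguration) ∧
      ((∀ B B', B ≠ B' → Disjoint (F B).H.verts (F B').H.verts) ∧
        C.H.IsUnion fun B => (F B).H) ∧
      (∀ v ∈ D.verts, C.X v = ⋃ (B) (_ : v ∈ B.1.verts), (F B).X v) := by
  have hC : C.Bad := ⟨hdeg, hmin.2.1⟩
  refine ⟨fun B => C.blockCover B.1 B.2, ⟨fun B => blockCover_classification hC hmin B.2,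
    ⟨fun B B' hne => ?_, ?_, fun x y => ⟨fun hxy => ?_, ?_⟩⟩, fun v hv => ?_⟩, ?_⟩
  · rw [Set.disjoint_left]
    rintro x ⟨-, v, hv⟩ ⟨-, v', hv'⟩
    obtain rfl := eq_of_mem hv.1 hv'.1
    exact hne (Subtype.ext (eq_of_mem_blockX hC B.2 B'.2 hv hv'))
  · ext x
    rw [Set.mem_iUnion]
    constructor
    · intro hx
      have hx' := hx
      rw [C.verts_eq] at hx'
      simp only [Set.mem_iUnion] at hx'
      obtain ⟨v, -, hv⟩ := hx'
      obtain ⟨B, hB, h⟩ := exists_mem_blockX hC hmin hv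
      exact ⟨⟨B, hB⟩, hx, v, h⟩
    · rintro ⟨B, hx, -⟩
      exact hx
  · obtain ⟨u, v, huv, hx, hy⟩ := C.arc x y hxy
    obtain ⟨B, hB, hu, hv, -⟩ := FinDigraph.exists_block_of_walk (.inl huv) (.inl huv) .refl
    exact ⟨⟨B, hB⟩, (blockCover_arc_iff hC hmin hB hx hy hu hv).2 hxy⟩
  · rintro ⟨B, h⟩
    exact h.1
  · ext x
    simp only [Set.mem_iUnion]
    constructor
    · intro hx
      obtain ⟨B, hB, h⟩ := exists_mem_blockX hC hmin hx
      exact ⟨⟨B, hB⟩, mem_verts_of_mem_blockX h, h⟩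
    · rintro ⟨B, -, h⟩
      exact h.1
  · rintro F ⟨hconf, ⟨-, hunion⟩, hX⟩
    have hmemX : ∀ B v x, x ∈ (F B).X v → x ∈ C.X v := by
      intro B v x hx
      have hv := mem_verts_of_mem hx
      rw [hX v (B.2.prop.1.1 hv)]
      simp only [Set.mem_iUnion]
      exact ⟨B, hv, hx⟩
    -- A color of `F B` has an arc in `F B`, which is an arc of `H` over `B`, so the color lies in
    -- `blockX`. As both families partition the colors, equality follows.
    have hsub : ∀ B v x, x ∈ (F B).X v → x ∈ C.blockX B.1 v := by
      intro B v x hx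
      obtain ⟨y, hxy⟩ := exists_arc_of_configuration (hconf B) hx
      obtain ⟨u, w, huw, hxu, hyw⟩ := (F B).arc x y hxy
      obtain rfl := eq_of_mem hx hxu
      exact (mem_blockX_of_arc hC hmin B.2 ((hunion.2 x y).2 ⟨B, hxy⟩) (hmemX B _ x hx)
        (hmemX B w y hyw) (FinDigraph.left_mem _ huw) (FinDigraph.right_mem _ huw)).1
    have hXeq : ∀ B v, (F B).X v = C.blockX B.1 v := by
      intro B v
      refine Set.Subset.antisymm (fun x => hsub B v x) fun x hx => ?_
      have hx' := hx.1
      rw [hX v (mem_verts_of_mem hx.1)] at hx'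
      simp only [Set.mem_iUnion] at hx'
      obtain ⟨B', -, h'⟩ := hx'
      obtain rfl : B' = B := Subtype.ext (eq_of_mem_blockX hC B'.2 B.2 (hsub B' v x h') hx)
      exact h'
    funext B
    have hXB : (F B).X = (C.blockCover B.1 B.2).X := funext (hXeq B)
    have hV : (F B).H.verts = (C.blockCover B.1 B.2).H.verts := by
      rw [(F B).verts_eq, (C.blockCover B.1 B.2).verts_eq, hXB]
    refine DigraphCover.ext hXB ?_
    ext x y
    · rw [hV]
    · constructor
      · intro hxy
        have hx := FinDigraph.left_mem _ hxy
        have hy := FinDigraph.right_mem _ hxy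
        rw [hV] at hx hy
        exact ⟨(hunion.2 x y).2 ⟨B, hxy⟩, hx.2, hy.2⟩
      · rintro ⟨hxy, ⟨u, hu⟩, -⟩
        obtain ⟨B', h'⟩ := (hunion.2 x y).1 hxy
        obtain ⟨u', v', -, hx', -⟩ := (F B').arc x y h'
        obtain rfl := eq_of_mem hu.1 (hmemX B' _ _ hx')
        obtain rfl : B' = B := Subtype.ext (eq_of_mem_blockX hC B'.2 B.2 (hsub B' _ x hx') hu)
        exact h'
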